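/- Let $X$ be a compact Hausdorff space. A unital $C(X)$-algebra is a unital C*-algebra $A$ with a unital $*$-homomorphism $\theta$ from $C(X)$ to the centre of $A$. Its fibre at $x\in X$ is the quotient C*-algebra $A_x=A/\overline{C_x(X)A}$, where $C_x(X)=\{f\in C(X): f(x)=0\}$, and $a_x$ denotes the image of $a\in A$ in $A_x$. The $C(X)$-algebra $A$ is continuous if $x\mapsto\|a_x\|$ is continuous on $X$ for every $a\in A$. Let $A_1,A_2$ be two unital $C(X)$-algebras with structure homomorphisms $\theta_1,\theta_2$. Their algebraic amalgamated free product $A_1\circledast_{C(X)}A_2$ is the quotient of the unital algebraic free product of $A_1$ and $A_2$ over $\mathbb{C}$ (units identified) by the two-sided ideal generated by the differences $\theta_1(f)-\theta_2(f)$, $f\in C(X)$; it is a unital $*$-algebra. The full amalgamated free product $\mathcal{A}=A_1*^f_{C(X)}A_2$ is the universal unital enveloping C*-algebra of this $*$-algebra, i.e. its separated completion for the seminorm $p\mapsto\sup_\varphi\|\varphi(p)\|$, where $\varphi$ runs over the unital $*$-homomorphisms into unital C*-algebras. It is a unital $C(X)$-algebra through the common image of $C(X)$. For unital C*-algebras $D_1,D_2$,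 their full free product $D_1*^f D_2$ is the same construction with $\mathbb{C}$ and its unital inclusions in place of $C(X)$ and $\theta_1,\theta_2$. Write $\iota_i$ for the canonical $*$-homomorphisms from the two factors into a full free product. **Theorem.** Let $X$ be a compact Hausdorff space and let $A_1,A_2$ be two unital continuous $C(X)$-algebras. Then $\mathcal{A}=A_1*^f_{C(X)}A_2$ is a continuous $C(X)$-algebra, with fibres $\mathcal{A}_x=(A_1)_x*^f(A_2)_x$: for every $x\in X$ there is a $*$-isomorphism $\mathcal{A}_x\cong (A_1)_x*^f(A_2)_x$ which maps $\iota_i(a)_x$ to $\iota_i(a_x)$ for all $a\in A_i$, $i=1,2$. (No exactness or separability is assumed.) -/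

import Mathlib

/-! ### The algebraic free product with amalgamation -/

namespace AmalgFree

universe u v w

section Algebraic

variable {B : Type w} {A₁ : Type u} {A₂ : Type v} [CStarAlgebra B] [CStarAlgebra A₁]
  [CStarAlgebra A₂]

/-- The relations which present the unital algebra generated by `A₁` and `A₂`, in which the unital
algebra structures of `A₁` and `A₂` are kept and the two images of each `b : B` are identified. -/
inductive Rel (θ₁ : B →⋆ₐ[ℂ] A₁) (θ₂ : B →⋆ₐ[ℂ] A₂) :
    FreeAlgebra ℂ (A₁ ⊕ A₂) → FreeAlgebra ℂ (A₁ ⊕ A₂) → Prop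
  | inl_add (a b : A₁) : Rel θ₁ θ₂ (FreeAlgebra.ι ℂ (Sum.inl (a + b)))
      (FreeAlgebra.ι ℂ (Sum.inl a) + FreeAlgebra.ι ℂ (Sum.inl b))
  | inl_mul (a b : A₁) : Rel θ₁ θ₂ (FreeAlgebra.ι ℂ (Sum.inl (a * b)))
      (FreeAlgebra.ι ℂ (Sum.inl a) * FreeAlgebra.ι ℂ (Sum.inl b))
  | inl_scalar (c : ℂ) : Rel θ₁ θ₂ (FreeAlgebra.ι ℂ (Sum.inl (algebraMap ℂ A₁ c)))
      (algebraMap ℂ (FreeAlgebra ℂ (A₁ ⊕ A₂)) c)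
  | inr_add (a b : A₂) : Rel θ₁ θ₂ (FreeAlgebra.ι ℂ (Sum.inr (a + b)))
      (FreeAlgebra.ι ℂ (Sum.inr a) + FreeAlgebra.ι ℂ (Sum.inr b))
  | inr_mul (a b : A₂) : Rel θ₁ θ₂ (FreeAlgebra.ι ℂ (Sum.inr (a * b)))
      (FreeAlgebra.ι ℂ (Sum.inr a) * FreeAlgebra.ι ℂ (Sum.inr b))
  | inr_scalar (c : ℂ) : Rel θ₁ θ₂ (FreeAlgebra.ι ℂ (Sum.inr (algebraMap ℂ A₂ c)))
      (algebraMap ℂ (FreeAlgebra ℂ (A₁ ⊕ A₂)) c)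
  | amalg (b : B) : Rel θ₁ θ₂ (FreeAlgebra.ι ℂ (Sum.inl (θ₁ b)))
      (FreeAlgebra.ι ℂ (Sum.inr (θ₂ b)))

/-- The algebraic free product `A₁ ⊛_B A₂` of `A₁` and `A₂` with amalgamation over `B`. -/
def AlgFreeProd (θ₁ : B →⋆ₐ[ℂ] A₁) (θ₂ : B →⋆ₐ[ℂ] A₂) : Type (max u v) :=
  RingQuot (Rel θ₁ θ₂)

namespace AlgFreeProd

variable (θ₁ : B →⋆ₐ[ℂ] A₁) (θ₂ : B →⋆ₐ[ℂ] A₂)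

noncomputable instance instRing : Ring (AlgFreeProd θ₁ θ₂) :=
  inferInstanceAs (Ring (RingQuot (Rel θ₁ θ₂)))

noncomputable instance instAlgebra : Algebra ℂ (AlgFreeProd θ₁ θ₂) :=
  inferInstanceAs (Algebra ℂ (RingQuot (Rel θ₁ θ₂)))

/-- The quotient map from the free algebra. -/
noncomputable def mk : FreeAlgebra ℂ (A₁ ⊕ A₂) →ₐ[ℂ] AlgFreeProd θ₁ θ₂ :=
  RingQuot.mkAlgHom ℂ (Rel θ₁ θ₂)

theorem mk_surjective : Function.Surjective (mk θ₁ θ₂) :=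
  RingQuot.mkAlgHom_surjective ℂ (Rel θ₁ θ₂)

theorem mk_rel {p q : FreeAlgebra ℂ (A₁ ⊕ A₂)} (h : Rel θ₁ θ₂ p q) :
    mk θ₁ θ₂ p = mk θ₁ θ₂ q :=
  RingQuot.mkAlgHom_rel ℂ h

/-- The canonical homomorphism `A₁ → A₁ ⊛_B A₂`. -/
noncomputable def inl : A₁ →ₐ[ℂ] AlgFreeProd θ₁ θ₂ where
  toFun a := mk θ₁ θ₂ (FreeAlgebra.ι ℂ (Sum.inl a))
  map_one' := by simpa using mk_rel θ₁ θ₂ (Rel.inl_scalar 1)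
  map_mul' a b := by simpa using mk_rel θ₁ θ₂ (Rel.inl_mul a b)
  map_zero' := by simpa using mk_rel θ₁ θ₂ (Rel.inl_scalar 0)
  map_add' a b := by simpa using mk_rel θ₁ θ₂ (Rel.inl_add a b)
  commutes' c := by simpa using mk_rel θ₁ θ₂ (Rel.inl_scalar c)

/-- The canonical homomorphism `A₂ → A₁ ⊛_B A₂`. -/
noncomputable def inr : A₂ →ₐ[ℂ] AlgFreeProd θ₁ θ₂ where
  toFun a := mk θ₁ θ₂ (FreeAlgebra.ι ℂ (Sum.inr a))
  map_one' := by simpa using mk_rel θ₁ θ₂ (Rel.inr_scalar 1)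
  map_mul' a b := by simpa using mk_rel θ₁ θ₂ (Rel.inr_mul a b)
  map_zero' := by simpa using mk_rel θ₁ θ₂ (Rel.inr_scalar 0)
  map_add' a b := by simpa using mk_rel θ₁ θ₂ (Rel.inr_add a b)
  commutes' c := by simpa using mk_rel θ₁ θ₂ (Rel.inr_scalar c)

theorem inl_amalg (b : B) : inl θ₁ θ₂ (θ₁ b) = inr θ₁ θ₂ (θ₂ b) :=
  mk_rel θ₁ θ₂ (Rel.amalg b)

/-- `A₁ ⊛_B A₂` is generated, as a unital algebra, by the images of `A₁` and `A₂`. -/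
theorem induction {C : AlgFreeProd θ₁ θ₂ → Prop}
    (scalar : ∀ c : ℂ, C (algebraMap ℂ _ c)) (hl : ∀ a, C (inl θ₁ θ₂ a))
    (hr : ∀ a, C (inr θ₁ θ₂ a)) (add : ∀ p q, C p → C q → C (p + q))
    (mul : ∀ p q, C p → C q → C (p * q)) (p : AlgFreeProd θ₁ θ₂) : C p := by
  obtain ⟨f, rfl⟩ := mk_surjective θ₁ θ₂ p
  induction f using FreeAlgebra.induction with
  | grade0 c => simpa using scalar c
  | grade1 s =>
    rcases s with a | a
    · exact hl a
    · exact hr a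
  | mul f g hf hg => simpa using mul _ _ hf hg
  | add f g hf hg => simpa using add _ _ hf hg

/-- The homomorphism from `A₁ ⊛_B A₂` defined by a pair of unital homomorphisms of `A₁` and `A₂`
which coincide on `B`. -/
noncomputable def lift {C : Type*} [Ring C] [Algebra ℂ C] (σ₁ : A₁ →ₐ[ℂ] C) (σ₂ : A₂ →ₐ[ℂ] C)
    (h : ∀ b, σ₁ (θ₁ b) = σ₂ (θ₂ b)) : AlgFreeProd θ₁ θ₂ →ₐ[ℂ] C :=
  RingQuot.liftAlgHom ℂ (s := Rel θ₁ θ₂) ⟨FreeAlgebra.lift ℂ (Sum.elim σ₁ σ₂), by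
    intro p q hpq
    cases hpq <;> simp [h]⟩

theorem lift_inl {C : Type*} [Ring C] [Algebra ℂ C] (σ₁ : A₁ →ₐ[ℂ] C) (σ₂ : A₂ →ₐ[ℂ] C)
    (h : ∀ b, σ₁ (θ₁ b) = σ₂ (θ₂ b)) (a : A₁) :
    lift θ₁ θ₂ σ₁ σ₂ h (inl θ₁ θ₂ a) = σ₁ a := by
  have := RingQuot.liftAlgHom_mkAlgHom_apply ℂ (s := Rel θ₁ θ₂)
    (FreeAlgebra.lift ℂ (Sum.elim σ₁ σ₂)) (by intro p q hpq; cases hpq <;> simp [h])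
    (FreeAlgebra.ι ℂ (Sum.inl a))
  exact this.trans (by simp)

theorem lift_inr {C : Type*} [Ring C] [Algebra ℂ C] (σ₁ : A₁ →ₐ[ℂ] C) (σ₂ : A₂ →ₐ[ℂ] C)
    (h : ∀ b, σ₁ (θ₁ b) = σ₂ (θ₂ b)) (a : A₂) :
    lift θ₁ θ₂ σ₁ σ₂ h (inr θ₁ θ₂ a) = σ₂ a := by
  have := RingQuot.liftAlgHom_mkAlgHom_apply ℂ (s := Rel θ₁ θ₂)
    (FreeAlgebra.lift ℂ (Sum.elim σ₁ σ₂)) (by intro p q hpq; cases hpq <;> simp [h])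
    (FreeAlgebra.ι ℂ (Sum.inr a))
  exact this.trans (by simp)

end AlgFreeProd

/-- The opposite ring of a complex algebra, with complex conjugate scalars: an algebra homomorphism
into it is a conjugate-linear antihomomorphism into the algebra. -/
def ConjOp (P : Type*) : Type _ := Pᵐᵒᵖ

noncomputable instance ConjOp.instRing (P : Type*) [Ring P] : Ring (ConjOp P) :=
  inferInstanceAs (Ring Pᵐᵒᵖ)

noncomputable instance ConjOp.instAlgebra (P : Type*) [Ring P] [Algebra ℂ P] :
    Algebra ℂ (ConjOp P) :=
  RingHom.toAlgebra' ((algebraMap ℂ Pᵐᵒᵖ).comp (starRingEnd ℂ)) fun c x =>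
    Algebra.commutes (A := Pᵐᵒᵖ) (starRingEnd ℂ c) x

namespace AlgFreeProd

variable (θ₁ : B →⋆ₐ[ℂ] A₁) (θ₂ : B →⋆ₐ[ℂ] A₂)

/-- The conjugate-linear antihomomorphism which extends the adjoint on `A₁`. -/
noncomputable def starInl : A₁ →ₐ[ℂ] ConjOp (AlgFreeProd θ₁ θ₂) where
  toFun a := MulOpposite.op (inl θ₁ θ₂ (star a))
  map_one' := by simp; rfl
  map_mul' a b := by rw [star_mul, map_mul]; rfl
  map_zero' := by simp; rfl
  map_add' a b := by rw [star_add, map_add]; rfl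
  commutes' c := by
    rw [← algebraMap_star_comm, AlgHom.commutes]; rfl

/-- The conjugate-linear antihomomorphism which extends the adjoint on `A₂`. -/
noncomputable def starInr : A₂ →ₐ[ℂ] ConjOp (AlgFreeProd θ₁ θ₂) where
  toFun a := MulOpposite.op (inr θ₁ θ₂ (star a))
  map_one' := by simp; rfl
  map_mul' a b := by rw [star_mul, map_mul]; rfl
  map_zero' := by simp; rfl
  map_add' a b := by rw [star_add, map_add]; rfl
  commutes' c := by
    rw [← algebraMap_star_comm, AlgHom.commutes]; rfl

/-- The adjoint, as a homomorphism into the conjugate opposite algebra. -/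
noncomputable def starHom : AlgFreeProd θ₁ θ₂ →ₐ[ℂ] ConjOp (AlgFreeProd θ₁ θ₂) :=
  lift θ₁ θ₂ (starInl θ₁ θ₂) (starInr θ₁ θ₂) fun b => by
    change MulOpposite.op (inl θ₁ θ₂ (star (θ₁ b))) = MulOpposite.op (inr θ₁ θ₂ (star (θ₂ b)))
    rw [← map_star, ← map_star, inl_amalg]

/-- The conjugate-linear involution of `A₁ ⊛_B A₂` which reverses products and extends the adjoints
of `A₁` and `A₂`. -/
noncomputable instance instStar : Star (AlgFreeProd θ₁ θ₂) where
  star p := MulOpposite.unop (starHom θ₁ θ₂ p)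

theorem star_inl (a : A₁) : star (inl θ₁ θ₂ a) = inl θ₁ θ₂ (star a) :=
  congrArg MulOpposite.unop (lift_inl θ₁ θ₂ (starInl θ₁ θ₂) (starInr θ₁ θ₂) _ a)

theorem star_inr (a : A₂) : star (inr θ₁ θ₂ a) = inr θ₁ θ₂ (star a) :=
  congrArg MulOpposite.unop (lift_inr θ₁ θ₂ (starInl θ₁ θ₂) (starInr θ₁ θ₂) _ a)

theorem star_algebraMap (c : ℂ) :
    star (algebraMap ℂ (AlgFreeProd θ₁ θ₂) c) = algebraMap ℂ _ (star c) :=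
  congrArg MulOpposite.unop ((starHom θ₁ θ₂).commutes c)

theorem star_add_aux (p q : AlgFreeProd θ₁ θ₂) : star (p + q) = star p + star q :=
  congrArg MulOpposite.unop (map_add (starHom θ₁ θ₂) p q)

theorem star_mul_aux (p q : AlgFreeProd θ₁ θ₂) : star (p * q) = star q * star p :=
  congrArg MulOpposite.unop (map_mul (starHom θ₁ θ₂) p q)

noncomputable instance instStarRing : StarRing (AlgFreeProd θ₁ θ₂) where
  star_involutive p := by
    induction p using induction θ₁ θ₂ with
    | scalar c => simp [star_algebraMap]
    | hl a => simp [star_inl]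
    | hr a => simp [star_inr]
    | add p q hp hq => rw [star_add_aux, star_add_aux, hp, hq]
    | mul p q hp hq => rw [star_mul_aux, star_mul_aux, hp, hq]
  star_mul := star_mul_aux θ₁ θ₂
  star_add := star_add_aux θ₁ θ₂

instance instStarModule : StarModule ℂ (AlgFreeProd θ₁ θ₂) where
  star_smul c p := by
    rw [Algebra.smul_def, star_mul, star_algebraMap, ← Algebra.commutes, ← Algebra.smul_def]

/-- The canonical homomorphism `A₁ → A₁ ⊛_B A₂` as a homomorphism of `*`-algebras. -/
noncomputable def inlStar : A₁ →⋆ₐ[ℂ] AlgFreeProd θ₁ θ₂ :=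
  { inl θ₁ θ₂ with map_star' := fun a => (star_inl θ₁ θ₂ a).symm }

/-- The canonical homomorphism `A₂ → A₁ ⊛_B A₂` as a homomorphism of `*`-algebras. -/
noncomputable def inrStar : A₂ →⋆ₐ[ℂ] AlgFreeProd θ₁ θ₂ :=
  { inr θ₁ θ₂ with map_star' := fun a => (star_inr θ₁ θ₂ a).symm }

end AlgFreeProd

/-! ### The full free product with amalgamation -/

namespace AlgFreeProd

variable (θ₁ : B →⋆ₐ[ℂ] A₁) (θ₂ : B →⋆ₐ[ℂ] A₂)

/-- The norms of the images of `p` under all unital `*`-homomorphisms of `A₁ ⊛_B A₂` into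
C⋆-algebras. (The separated completion of `A₁ ⊛_B A₂` for any C⋆-seminorm lives in the universe of
`A₁ ⊛_B A₂`, so C⋆-algebras of other universes would contribute no further norms.) -/
def normSet (p : AlgFreeProd θ₁ θ₂) : Set ℝ :=
  {r | ∃ (C : Type (max u v)) (_ : CStarAlgebra C) (φ : AlgFreeProd θ₁ θ₂ →⋆ₐ[ℂ] C), r = ‖φ p‖}

theorem zero_mem_normSet (p : AlgFreeProd θ₁ θ₂) : (0 : ℝ) ∈ normSet θ₁ θ₂ p := by
  let φ : AlgFreeProd θ₁ θ₂ →⋆ₐ[ℂ] ((i : PEmpty.{max u v + 1}) → ℂ) :=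
    { toFun := 0
      map_one' := Subsingleton.elim _ _
      map_mul' := fun _ _ => Subsingleton.elim _ _
      map_zero' := Subsingleton.elim _ _
      map_add' := fun _ _ => Subsingleton.elim _ _
      commutes' := fun _ => Subsingleton.elim _ _
      map_star' := fun _ => Subsingleton.elim _ _ }
  refine ⟨_, inferInstance, φ, ?_⟩
  rw [Subsingleton.elim (φ p) 0, norm_zero]

theorem bddAbove_normSet (p : AlgFreeProd θ₁ θ₂) : BddAbove (normSet θ₁ θ₂ p) := by
  induction p using induction θ₁ θ₂ with
  | scalar c =>
    refine ⟨‖algebraMap ℂ A₁ c‖, ?_⟩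
    rintro _ ⟨C, _, φ, rfl⟩
    rw [← AlgHom.commutes (inl θ₁ θ₂) c]
    exact NonUnitalStarAlgHom.norm_apply_le (φ.comp (inlStar θ₁ θ₂)) (algebraMap ℂ A₁ c)
  | hl a =>
    refine ⟨‖a‖, ?_⟩
    rintro _ ⟨C, _, φ, rfl⟩
    exact NonUnitalStarAlgHom.norm_apply_le (φ.comp (inlStar θ₁ θ₂)) a
  | hr a =>
    refine ⟨‖a‖, ?_⟩
    rintro _ ⟨C, _, φ, rfl⟩
    exact NonUnitalStarAlgHom.norm_apply_le (φ.comp (inrStar θ₁ θ₂)) a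
  | add p q hp hq =>
    obtain ⟨M, hM⟩ := hp
    obtain ⟨N, hN⟩ := hq
    refine ⟨M + N, ?_⟩
    rintro _ ⟨C, _, φ, rfl⟩
    rw [map_add]
    exact (norm_add_le _ _).trans (add_le_add (hM ⟨C, _, φ, rfl⟩) (hN ⟨C, _, φ, rfl⟩))
  | mul p q hp hq =>
    obtain ⟨M, hM⟩ := hp
    obtain ⟨N, hN⟩ := hq
    refine ⟨M * N, ?_⟩
    rintro _ ⟨C, _, φ, rfl⟩
    rw [map_mul]
    exact (norm_mul_le _ _).trans (mul_le_mul (hM ⟨C, _, φ, rfl⟩) (hN ⟨C, _, φ, rfl⟩)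
      (norm_nonneg _) ((norm_nonneg _).trans (hM ⟨C, _, φ, rfl⟩)))

/-- The greatest C⋆-seminorm on `A₁ ⊛_B A₂`. -/
noncomputable instance instNorm : Norm (AlgFreeProd θ₁ θ₂) where
  norm p := sSup (normSet θ₁ θ₂ p)

theorem norm_hom_le {C : Type (max u v)} [CStarAlgebra C] (φ : AlgFreeProd θ₁ θ₂ →⋆ₐ[ℂ] C)
    (p : AlgFreeProd θ₁ θ₂) : ‖φ p‖ ≤ ‖p‖ :=
  le_csSup (bddAbove_normSet θ₁ θ₂ p) ⟨C, _, φ, rfl⟩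

theorem norm_le_of_forall {p : AlgFreeProd θ₁ θ₂} {M : ℝ}
    (h : ∀ (C : Type (max u v)) (_ : CStarAlgebra C) (φ : AlgFreeProd θ₁ θ₂ →⋆ₐ[ℂ] C), ‖φ p‖ ≤ M) :
    ‖p‖ ≤ M := by
  refine csSup_le ⟨0, zero_mem_normSet θ₁ θ₂ p⟩ ?_
  rintro _ ⟨C, _, φ, rfl⟩
  exact h C _ φ

theorem norm_nonneg_aux (p : AlgFreeProd θ₁ θ₂) : 0 ≤ ‖p‖ :=
  le_csSup (bddAbove_normSet θ₁ θ₂ p) (zero_mem_normSet θ₁ θ₂ p)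

noncomputable instance instSeminormedRing : SeminormedRing (AlgFreeProd θ₁ θ₂) :=
  { instRing θ₁ θ₂, AddGroupSeminorm.toSeminormedAddCommGroup
      { toFun := fun p : AlgFreeProd θ₁ θ₂ => ‖p‖
        map_zero' := le_antisymm
          (norm_le_of_forall θ₁ θ₂ fun C _ φ => by simp) (norm_nonneg_aux θ₁ θ₂ 0)
        add_le' := fun p q => norm_le_of_forall θ₁ θ₂ fun C _ φ => by
          rw [map_add]
          exact (norm_add_le _ _).trans
            (add_le_add (norm_hom_le θ₁ θ₂ φ p) (norm_hom_le θ₁ θ₂ φ q))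
        neg' := fun p => congrArg sSup <| by simp [normSet] } with
    norm_mul_le := fun p q => norm_le_of_forall θ₁ θ₂ fun C _ φ => by
      rw [map_mul]
      exact (norm_mul_le _ _).trans (mul_le_mul (norm_hom_le θ₁ θ₂ φ p) (norm_hom_le θ₁ θ₂ φ q)
        (norm_nonneg _) (norm_nonneg_aux θ₁ θ₂ p)) }

noncomputable instance instNormedAlgebra : NormedAlgebra ℂ (AlgFreeProd θ₁ θ₂) :=
  { instAlgebra θ₁ θ₂ with
    norm_smul_le := fun c p => norm_le_of_forall θ₁ θ₂ fun C _ φ => by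
      rw [map_smul, norm_smul]
      exact mul_le_mul_of_nonneg_left (norm_hom_le θ₁ θ₂ φ p) (norm_nonneg c) }

theorem norm_star_le (p : AlgFreeProd θ₁ θ₂) : ‖star p‖ ≤ ‖p‖ :=
  norm_le_of_forall θ₁ θ₂ fun C _ φ => by
    rw [map_star, norm_star]
    exact norm_hom_le θ₁ θ₂ φ p

instance instNormedStarGroup : NormedStarGroup (AlgFreeProd θ₁ θ₂) where
  norm_star_le := norm_star_le θ₁ θ₂

theorem norm_mul_self_le_aux (p : AlgFreeProd θ₁ θ₂) : ‖p‖ * ‖p‖ ≤ ‖star p * p‖ := by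
  have h : ‖p‖ ≤ √‖star p * p‖ := norm_le_of_forall θ₁ θ₂ fun C _ φ => by
    refine Real.le_sqrt_of_sq_le ?_
    rw [sq, ← CStarRing.norm_star_mul_self, ← map_star, ← map_mul]
    exact norm_hom_le θ₁ θ₂ φ _
  calc ‖p‖ * ‖p‖ ≤ √‖star p * p‖ * √‖star p * p‖ :=
        mul_self_le_mul_self (norm_nonneg_aux θ₁ θ₂ p) h
    _ = ‖star p * p‖ := Real.mul_self_sqrt (norm_nonneg_aux θ₁ θ₂ _)

end AlgFreeProd

/-- The full free product `A₁ *ᶠ_B A₂` of `A₁` and `A₂` with amalgamation over `B`: the universal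
unital enveloping C⋆-algebra of the `*`-algebra `A₁ ⊛_B A₂`. -/
def FullFreeProd (θ₁ : B →⋆ₐ[ℂ] A₁) (θ₂ : B →⋆ₐ[ℂ] A₂) : Type (max u v) :=
  UniformSpace.Completion (AlgFreeProd θ₁ θ₂)

namespace FullFreeProd

variable (θ₁ : B →⋆ₐ[ℂ] A₁) (θ₂ : B →⋆ₐ[ℂ] A₂)

noncomputable instance instNormedRing : NormedRing (FullFreeProd θ₁ θ₂) :=
  inferInstanceAs (NormedRing (UniformSpace.Completion (AlgFreeProd θ₁ θ₂)))

instance instCompleteSpace : CompleteSpace (FullFreeProd θ₁ θ₂) :=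
  inferInstanceAs (CompleteSpace (UniformSpace.Completion (AlgFreeProd θ₁ θ₂)))

noncomputable instance instAlgebra : Algebra ℂ (FullFreeProd θ₁ θ₂) :=
  inferInstanceAs (Algebra ℂ (UniformSpace.Completion (AlgFreeProd θ₁ θ₂)))

noncomputable instance instNormedAlgebra : NormedAlgebra ℂ (FullFreeProd θ₁ θ₂) :=
  { instAlgebra θ₁ θ₂ with
    norm_smul_le := fun c p =>
      norm_smul_le (β := UniformSpace.Completion (AlgFreeProd θ₁ θ₂)) c p }

/-- The canonical map of the algebraic free product into the full one. -/
noncomputable def coe : AlgFreeProd θ₁ θ₂ →ₐ[ℂ] FullFreeProd θ₁ θ₂ :=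
  { (UniformSpace.Completion.coeRingHom :
      AlgFreeProd θ₁ θ₂ →+* UniformSpace.Completion (AlgFreeProd θ₁ θ₂)) with
    commutes' := fun _ => rfl }

theorem norm_coe (p : AlgFreeProd θ₁ θ₂) : ‖coe θ₁ θ₂ p‖ = ‖p‖ :=
  UniformSpace.Completion.norm_coe p

theorem continuous_coe : Continuous (coe θ₁ θ₂) :=
  UniformSpace.Completion.continuous_coe _

theorem denseRange_coe : DenseRange (coe θ₁ θ₂) :=
  UniformSpace.Completion.denseRange_coe

/-- The involution of the full free product: the continuous extension of that of the algebraic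
one. -/
noncomputable instance instStar : Star (FullFreeProd θ₁ θ₂) where
  star := UniformSpace.Completion.map (star : AlgFreeProd θ₁ θ₂ → AlgFreeProd θ₁ θ₂)

theorem continuous_star_aux : Continuous (star : FullFreeProd θ₁ θ₂ → FullFreeProd θ₁ θ₂) :=
  UniformSpace.Completion.continuous_map

theorem star_coe (p : AlgFreeProd θ₁ θ₂) : star (coe θ₁ θ₂ p) = coe θ₁ θ₂ (star p) :=
  UniformSpace.Completion.map_coe
    (starNormedAddGroupHom (E := AlgFreeProd θ₁ θ₂)).uniformContinuous p

theorem induction {C : FullFreeProd θ₁ θ₂ → Prop} (hC : IsClosed {z | C z})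
    (h : ∀ p, C (coe θ₁ θ₂ p)) (z : FullFreeProd θ₁ θ₂) : C z :=
  isClosed_property (denseRange_coe θ₁ θ₂) hC h z

noncomputable instance instStarRing : StarRing (FullFreeProd θ₁ θ₂) where
  star_involutive z := by
    have hs := continuous_star_aux θ₁ θ₂
    induction z using induction θ₁ θ₂ with
    | hC => exact isClosed_eq (hs.comp hs) continuous_id
    | h p => rw [star_coe, star_coe, star_star]
  star_mul z w := by
    have hs := continuous_star_aux θ₁ θ₂
    induction z using induction θ₁ θ₂ with
    | hC => exact isClosed_eq (hs.comp (continuous_mul_const w)) (continuous_const.mul hs)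
    | h p =>
      induction w using induction θ₁ θ₂ with
      | hC => exact isClosed_eq (hs.comp (continuous_const_mul _)) (hs.mul continuous_const)
      | h q => rw [← map_mul, star_coe, star_coe, star_coe, star_mul, map_mul]
  star_add z w := by
    have hs := continuous_star_aux θ₁ θ₂
    induction z using induction θ₁ θ₂ with
    | hC => exact isClosed_eq (hs.comp (continuous_add_const w)) (hs.add continuous_const)
    | h p =>
      induction w using induction θ₁ θ₂ with
      | hC => exact isClosed_eq (hs.comp (continuous_const_add _)) (continuous_const.add hs)
      | h q => rw [← map_add, star_coe, star_coe, star_coe, star_add, map_add]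

noncomputable instance instCStarAlgebra : CStarAlgebra (FullFreeProd θ₁ θ₂) :=
  { instNormedRing θ₁ θ₂, instStarRing θ₁ θ₂, instCompleteSpace θ₁ θ₂,
    instNormedAlgebra θ₁ θ₂ with
    norm_mul_self_le := fun z => by
      have hs := continuous_star_aux θ₁ θ₂
      induction z using induction θ₁ θ₂ with
      | hC =>
        exact isClosed_le (continuous_norm.mul continuous_norm)
          (continuous_norm.comp (hs.mul continuous_id))
      | h p =>
        rw [star_coe, ← map_mul, norm_coe, norm_coe]
        exact AlgFreeProd.norm_mul_self_le_aux θ₁ θ₂ p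
    star_smul := fun c z => by
      have hs := continuous_star_aux θ₁ θ₂
      induction z using induction θ₁ θ₂ with
      | hC =>
        exact isClosed_eq (hs.comp (continuous_const_smul c))
          ((continuous_const_smul (star c)).comp hs)
      | h p => rw [← map_smul, star_coe, star_coe, star_smul, map_smul] }

/-- The canonical `*`-homomorphism `A₁ → A₁ *ᶠ_B A₂`. -/
noncomputable def inl : A₁ →⋆ₐ[ℂ] FullFreeProd θ₁ θ₂ :=
  { (coe θ₁ θ₂).comp (AlgFreeProd.inl θ₁ θ₂) with
    map_star' := fun a =>
      (congrArg (coe θ₁ θ₂) (AlgFreeProd.star_inl θ₁ θ₂ a).symm).trans (star_coe θ₁ θ₂ _).symm }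

/-- The canonical `*`-homomorphism `A₂ → A₁ *ᶠ_B A₂`. -/
noncomputable def inr : A₂ →⋆ₐ[ℂ] FullFreeProd θ₁ θ₂ :=
  { (coe θ₁ θ₂).comp (AlgFreeProd.inr θ₁ θ₂) with
    map_star' := fun a =>
      (congrArg (coe θ₁ θ₂) (AlgFreeProd.star_inr θ₁ θ₂ a).symm).trans (star_coe θ₁ θ₂ _).symm }

theorem inl_amalg (b : B) : inl θ₁ θ₂ (θ₁ b) = inr θ₁ θ₂ (θ₂ b) :=
  congrArg (coe θ₁ θ₂) (AlgFreeProd.inl_amalg θ₁ θ₂ b)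

end FullFreeProd

end Algebraic

/-! ### Unital `C(X)`-algebras and their fibres -/

/-- The structure of a unital `C(X)`-algebra on the unital C⋆-algebra `A`: a unital
`*`-homomorphism from `C(X)` to the centre of `A` (`A` is its own multiplier algebra). -/
structure CXAlgebra (X : Type*) [TopologicalSpace X] [CompactSpace X] (A : Type*)
    [CStarAlgebra A] where
  /-- The structure homomorphism. -/
  hom : C(X, ℂ) →⋆ₐ[ℂ] A
  central : ∀ (f : C(X, ℂ)) (a : A), Commute (hom f) a

namespace CXAlgebra

section Fibre

variable {X : Type*} [TopologicalSpace X] [CompactSpace X] {A : Type*} [CStarAlgebra A]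
  (S : CXAlgebra X A) (x : X)

/-- The closed ideal `C_x(X) A` of `A`, where `C_x(X)` consists of the functions which vanish at
`x`. -/
def ideal : Ideal A := (Ideal.span (S.hom '' {f : C(X, ℂ) | f x = 0})).closure

theorem isClosed_ideal : IsClosed (S.ideal x : Set A) := isClosed_closure

instance instIsClosed : IsClosed (S.ideal x : Set A) := S.isClosed_ideal x

theorem hom_mem_ideal {f : C(X, ℂ)} (hf : f x = 0) : S.hom f ∈ S.ideal x :=
  subset_closure (Ideal.subset_span ⟨f, hf, rfl⟩)

/-- Closed sets which are stable under addition and hold all products `a f` with `f x = 0` hold the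
whole ideal. -/
theorem ideal_induction {C : A → Prop} (hC : IsClosed {a | C a}) (zero : C 0)
    (add : ∀ a b, C a → C b → C (a + b)) (gen : ∀ a (f : C(X, ℂ)), f x = 0 → C (a * S.hom f))
    {a : A} (ha : a ∈ S.ideal x) : C a := by
  refine closure_minimal (t := {a | C a}) ?_ hC ha
  intro b hb
  induction hb using Submodule.span_induction with
  | mem b hb =>
    obtain ⟨f, hf, rfl⟩ := hb
    simpa using gen 1 f hf
  | zero => exact zero
  | add b c _ _ hb hc => exact add b c hb hc
  | smul c b hb _ =>
    have key : ∀ b ∈ Ideal.span (S.hom '' {f : C(X, ℂ) | f x = 0}), ∀ c, C (c * b) := by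
      intro b hb
      induction hb using Submodule.span_induction with
      | mem b hb =>
        obtain ⟨f, hf, rfl⟩ := hb
        exact fun c => gen c f hf
      | zero => simpa using fun _ : A => zero
      | add b₁ b₂ _ _ h₁ h₂ => exact fun c => by rw [mul_add]; exact add _ _ (h₁ c) (h₂ c)
      | smul d b _ h => exact fun c => by rw [smul_eq_mul, ← mul_assoc]; exact h _
    exact key b hb c

instance instIsTwoSided : (S.ideal x).IsTwoSided where
  mul_mem_of_left {a} b ha := by
    refine S.ideal_induction x (C := fun a => a * b ∈ S.ideal x)
      ((S.isClosed_ideal x).preimage (continuous_mul_const b)) (by simp) ?_ ?_ ha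
    · intro c d hc hd
      rw [add_mul]
      exact add_mem hc hd
    · intro c f hf
      rw [mul_assoc, (S.central f b).eq, ← mul_assoc]
      exact Ideal.mul_mem_left _ _ (S.hom_mem_ideal x hf)

theorem star_mem_ideal {a : A} (ha : a ∈ S.ideal x) : star a ∈ S.ideal x := by
  refine S.ideal_induction x (C := fun a => star a ∈ S.ideal x)
    ((S.isClosed_ideal x).preimage continuous_star) (by simp) ?_ ?_ ha
  · intro c d hc hd
    rw [star_add]
    exact add_mem hc hd
  · intro c f hf
    rw [star_mul, ← map_star]
    refine Ideal.mul_mem_right _ _ (S.hom_mem_ideal x ?_)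
    simp [hf]

/-- The fibre `A_x = A / C_x(X) A`. -/
def Fiber : Type _ := A ⧸ S.ideal x

namespace Fiber

noncomputable instance instRing : Ring (S.Fiber x) :=
  inferInstanceAs (Ring (A ⧸ S.ideal x))

noncomputable instance instAlgebra : Algebra ℂ (S.Fiber x) :=
  inferInstanceAs (Algebra ℂ (A ⧸ S.ideal x))

/-- The quotient map `a ↦ a_x`. -/
noncomputable def mk : A →ₐ[ℂ] S.Fiber x := Ideal.Quotient.mkₐ ℂ (S.ideal x)

theorem mk_surjective : Function.Surjective (mk S x) := Ideal.Quotient.mk_surjective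

theorem mk_eq_mk {a b : A} : mk S x a = mk S x b ↔ a - b ∈ S.ideal x := Ideal.Quotient.eq

/-- The quotient norm. -/
noncomputable instance instNormedAddCommGroup : NormedAddCommGroup (S.Fiber x) :=
  inferInstanceAs (NormedAddCommGroup (A ⧸ S.ideal x))

instance instCompleteSpace : CompleteSpace (S.Fiber x) :=
  inferInstanceAs (CompleteSpace (A ⧸ S.ideal x))

theorem norm_mk_le (a : A) : ‖mk S x a‖ ≤ ‖a‖ := Submodule.Quotient.norm_mk_le _ a

theorem exists_norm_lt (z : S.Fiber x) {ε : ℝ} (hε : 0 < ε) :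
    ∃ a, mk S x a = z ∧ ‖a‖ < ‖z‖ + ε :=
  Submodule.Quotient.norm_mk_lt z hε

theorem norm_mk_mul_le (y z : S.Fiber x) : ‖y * z‖ ≤ ‖y‖ * ‖z‖ := by
  have h : ∀ ε : ℝ, 0 < ε → ‖y * z‖ ≤ (‖y‖ + ε) * (‖z‖ + ε) := by
    intro ε hε
    obtain ⟨a, rfl, ha⟩ := exists_norm_lt S x y hε
    obtain ⟨b, rfl, hb⟩ := exists_norm_lt S x z hε
    rw [← map_mul]
    exact ((norm_mk_le S x _).trans (norm_mul_le a b)).trans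
      (mul_le_mul ha.le hb.le (norm_nonneg _) ((norm_nonneg _).trans ha.le))
  have ht : Filter.Tendsto (fun ε : ℝ => (‖y‖ + ε) * (‖z‖ + ε)) (nhdsWithin 0 (Set.Ioi 0))
      (nhds (‖y‖ * ‖z‖)) := by
    have : Continuous fun ε : ℝ => (‖y‖ + ε) * (‖z‖ + ε) := by fun_prop
    simpa using (this.tendsto 0).mono_left nhdsWithin_le_nhds
  exact ge_of_tendsto ht (Filter.eventually_of_mem self_mem_nhdsWithin h)

noncomputable instance instNormedRing : NormedRing (S.Fiber x) :=
  { instRing S x, instNormedAddCommGroup S x with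
    norm_mul_le := norm_mk_mul_le S x }

noncomputable instance instNormedAlgebra : NormedAlgebra ℂ (S.Fiber x) :=
  { instAlgebra S x with
    norm_smul_le := fun c z => norm_smul_le (β := A ⧸ S.ideal x) c z }

/-- The adjoint, `(a_x)* = (a*)_x`. -/
noncomputable instance instStar : Star (S.Fiber x) where
  star := Quotient.map' star fun a b h => by
    rw [Submodule.quotientRel_def] at h ⊢
    rw [← star_sub]
    exact S.star_mem_ideal x h

theorem star_mk (a : A) : star (mk S x a) = mk S x (star a) := rfl

noncomputable instance instStarRing : StarRing (S.Fiber x) where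
  star_involutive z := by
    obtain ⟨a, rfl⟩ := mk_surjective S x z
    rw [star_mk, star_mk, star_star]
  star_mul y z := by
    obtain ⟨a, rfl⟩ := mk_surjective S x y
    obtain ⟨b, rfl⟩ := mk_surjective S x z
    rw [← map_mul, star_mk, star_mk, star_mk, star_mul, map_mul]
  star_add y z := by
    obtain ⟨a, rfl⟩ := mk_surjective S x y
    obtain ⟨b, rfl⟩ := mk_surjective S x z
    rw [← map_add, star_mk, star_mk, star_mk, star_add, map_add]

/-- Elements of the ideal become small when multiplied by suitable functions which take the value
`1` at `x`. -/
theorem exists_cutoff {a : A} (ha : a ∈ S.ideal x) {ε : ℝ} (hε : 0 < ε) :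
    ∃ f : C(X, ℂ), f x = 1 ∧ ‖f‖ ≤ 1 ∧ ‖a * S.hom f‖ < ε := by
  have hle : ∀ f : C(X, ℂ), ‖S.hom f‖ ≤ ‖f‖ := fun f => NonUnitalStarAlgHom.norm_apply_le S.hom f
  suffices h : ∀ ε : ℝ, 0 < ε → ∃ f : C(X, ℂ), f x = 1 ∧ ‖f‖ ≤ 1 ∧ ‖a * S.hom f‖ < ε from h ε hε
  refine S.ideal_induction x (C := fun a => ∀ ε : ℝ, 0 < ε →
    ∃ f : C(X, ℂ), f x = 1 ∧ ‖f‖ ≤ 1 ∧ ‖a * S.hom f‖ < ε) ?_ ?_ ?_ ?_ ha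
  · refine isClosed_of_closure_subset fun a ha ε hε => ?_
    obtain ⟨b, hb, hab⟩ := Metric.mem_closure_iff.1 ha (ε / 2) (by positivity)
    obtain ⟨f, hfx, hf, hbf⟩ := hb (ε / 2) (by positivity)
    refine ⟨f, hfx, hf, ?_⟩
    have h₁ : ‖(a - b) * S.hom f‖ ≤ ‖a - b‖ := (norm_mul_le _ _).trans
      (mul_le_of_le_one_right (norm_nonneg _) ((hle f).trans hf))
    calc ‖a * S.hom f‖ = ‖(a - b) * S.hom f + b * S.hom f‖ := by rw [sub_mul, sub_add_cancel]
      _ ≤ ‖(a - b) * S.hom f‖ + ‖b * S.hom f‖ := norm_add_le _ _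
      _ < ε / 2 + ε / 2 := add_lt_add (h₁.trans_lt (by rwa [← dist_eq_norm])) hbf
      _ = ε := add_halves ε
  · exact fun ε hε => ⟨1, rfl, (ContinuousMap.norm_le _ zero_le_one).2 (by simp), by simpa using hε⟩
  · intro a b ha hb ε hε
    obtain ⟨f, hfx, hf, haf⟩ := ha (ε / 2) (by positivity)
    obtain ⟨g, hgx, hg, hbg⟩ := hb (ε / 2) (by positivity)
    refine ⟨f * g, by simp [hfx, hgx], (norm_mul_le f g).trans (mul_le_one₀ hf (norm_nonneg _) hg),
      ?_⟩
    have h₁ : ‖a * S.hom (f * g)‖ ≤ ‖a * S.hom f‖ := by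
      rw [map_mul, ← mul_assoc]
      exact (norm_mul_le _ _).trans
        (mul_le_of_le_one_right (norm_nonneg _) ((hle g).trans hg))
    have h₂ : ‖b * S.hom (f * g)‖ ≤ ‖b * S.hom g‖ := by
      rw [mul_comm f g, map_mul, ← mul_assoc]
      exact (norm_mul_le _ _).trans
        (mul_le_of_le_one_right (norm_nonneg _) ((hle f).trans hf))
    rw [add_mul]
    linarith [norm_add_le (a * S.hom (f * g)) (b * S.hom (f * g))]
  · intro a g hg ε hε
    -- cut off by `δ / (δ + |g|)`
    obtain ⟨δ, hδ, hδε⟩ : ∃ δ : ℝ, 0 < δ ∧ ‖a‖ * δ < ε := by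
      refine ⟨ε / (‖a‖ + 1), by positivity, ?_⟩
      rw [mul_div_assoc', div_lt_iff₀ (by positivity)]
      nlinarith [norm_nonneg a]
    have hpos : ∀ y, 0 < δ + ‖g y‖ := fun y => by positivity
    let f : C(X, ℂ) := ⟨fun y => ((δ / (δ + ‖g y‖) : ℝ) : ℂ), by
      refine Complex.continuous_ofReal.comp (Continuous.div (by fun_prop) (by fun_prop) ?_)
      exact fun y => (hpos y).ne'⟩
    have hfn : ∀ y, ‖f y‖ = δ / (δ + ‖g y‖) := fun y => by
      change ‖((δ / (δ + ‖g y‖) : ℝ) : ℂ)‖ = _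
      rw [Complex.norm_real, Real.norm_of_nonneg (by positivity)]
    refine ⟨f, ?_, ?_, ?_⟩
    · change ((δ / (δ + ‖g x‖) : ℝ) : ℂ) = 1
      rw [hg, norm_zero, add_zero, div_self hδ.ne', Complex.ofReal_one]
    · refine (ContinuousMap.norm_le _ zero_le_one).2 fun y => ?_
      rw [hfn, div_le_one (hpos y)]
      linarith [norm_nonneg (g y)]
    · have hgf : ‖g * f‖ ≤ δ := (ContinuousMap.norm_le _ hδ.le).2 fun y => by
        rw [ContinuousMap.mul_apply, norm_mul, hfn, mul_div_assoc', div_le_iff₀ (hpos y)]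
        nlinarith [norm_nonneg (g y)]
      rw [mul_assoc, ← map_mul]
      refine lt_of_le_of_lt ((norm_mul_le _ _).trans ?_) hδε
      exact mul_le_mul_of_nonneg_left ((hle _).trans hgf) (norm_nonneg _)

theorem norm_mul_self_le_aux (z : S.Fiber x) : ‖z‖ * ‖z‖ ≤ ‖star z * z‖ := by
  have hle : ∀ f : C(X, ℂ), ‖S.hom f‖ ≤ ‖f‖ := fun f => NonUnitalStarAlgHom.norm_apply_le S.hom f
  obtain ⟨a, rfl⟩ := mk_surjective S x z
  refine le_of_forall_pos_lt_add fun ε hε => ?_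
  obtain ⟨b, hb, hbn⟩ := exists_norm_lt S x (star (mk S x a) * mk S x a) (half_pos hε)
  rw [star_mk, ← map_mul, mk_eq_mk] at hb
  obtain ⟨f, hfx, hf, hfb⟩ := exists_cutoff S x hb (half_pos hε)
  have hf' : ‖S.hom f‖ ≤ 1 := (hle f).trans hf
  have h₁ : mk S x (a * S.hom f) = mk S x a := by
    rw [mk_eq_mk, show a * S.hom f - a = a * S.hom (f - 1) by rw [map_sub, map_one]; noncomm_ring]
    exact Ideal.mul_mem_left _ _ (S.hom_mem_ideal x (by simp [hfx]))
  have h₂ : star (a * S.hom f) * (a * S.hom f) =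
      star (S.hom f) * (b * S.hom f) - star (S.hom f) * ((b - star a * a) * S.hom f) := by
    rw [star_mul]; noncomm_ring
  have h₃ : ∀ c : A, ‖star (S.hom f) * c‖ ≤ ‖c‖ := fun c => (norm_mul_le _ _).trans
    (mul_le_of_le_one_left (norm_nonneg _) (by rwa [norm_star]))
  calc ‖mk S x a‖ * ‖mk S x a‖ ≤ ‖a * S.hom f‖ * ‖a * S.hom f‖ := by
        rw [← h₁]
        exact mul_self_le_mul_self (norm_nonneg _) (norm_mk_le S x _)
    _ = ‖star (a * S.hom f) * (a * S.hom f)‖ := CStarRing.norm_star_mul_self.symm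
    _ ≤ ‖b * S.hom f‖ + ‖(b - star a * a) * S.hom f‖ := by
        rw [h₂]
        exact (norm_sub_le _ _).trans (add_le_add (h₃ _) (h₃ _))
    _ ≤ ‖b‖ + ‖(b - star a * a) * S.hom f‖ := by
        gcongr
        exact (norm_mul_le _ _).trans (mul_le_of_le_one_right (norm_nonneg _) hf')
    _ < ‖star (mk S x a) * mk S x a‖ + ε := by linarith

noncomputable instance instCStarAlgebra : CStarAlgebra (S.Fiber x) :=
  { instNormedRing S x, instStarRing S x, instCompleteSpace S x, instNormedAlgebra S x with
    norm_mul_self_le := norm_mul_self_le_aux S x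
    star_smul := fun c z => by
      obtain ⟨a, rfl⟩ := mk_surjective S x z
      rw [← map_smul, star_mk, star_mk, star_smul, map_smul] }

end Fiber

/-- A `C(X)`-algebra is continuous if `x ↦ ‖a_x‖` is continuous for every element `a`. -/
def IsContinuous : Prop := ∀ a : A, Continuous fun x : X => ‖Fiber.mk S x a‖

end Fibre

/-- The full free product `A₁ *ᶠ_{C(X)} A₂` with its structure of a `C(X)`-algebra, given by the
common image of `C(X)`. -/
noncomputable def fullFreeProd {X : Type*} [TopologicalSpace X] [CompactSpace X] {A₁ A₂ : Type*}
    [CStarAlgebra A₁] [CStarAlgebra A₂] (S₁ : CXAlgebra X A₁) (S₂ : CXAlgebra X A₂) :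
    CXAlgebra X (FullFreeProd S₁.hom S₂.hom) where
  hom := (FullFreeProd.inl S₁.hom S₂.hom).comp S₁.hom
  central f z := by
    induction z using FullFreeProd.induction S₁.hom S₂.hom with
    | hC => exact isClosed_eq (continuous_const_mul _) (continuous_mul_const _)
    | h p =>
      induction p using AlgFreeProd.induction S₁.hom S₂.hom with
      | scalar c =>
        rw [AlgHom.commutes]
        exact Algebra.commute_algebraMap_right c _
      | hl a => exact (S₁.central f a).map (FullFreeProd.inl S₁.hom S₂.hom)
      | hr a =>
        rw [StarAlgHom.comp_apply, FullFreeProd.inl_amalg]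
        exact (S₂.central f a).map (FullFreeProd.inr S₁.hom S₂.hom)
      | add p q hp hq => rw [map_add]; exact hp.add_right hq
      | mul p q hp hq => rw [map_mul]; exact hp.mul_right hq

end CXAlgebra

/-- The full free product `D₁ *ᶠ D₂` of unital C⋆-algebras (over the complex numbers, with the units
identified). -/
abbrev FullFreeProdC (D₁ D₂ : Type*) [CStarAlgebra D₁] [CStarAlgebra D₂] : Type _ :=
  FullFreeProd (StarAlgHom.ofId ℂ D₁) (StarAlgHom.ofId ℂ D₂)

end AmalgFree

/-! ### Positive functionals with prescribed approximate values -/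

section PositiveFunctional

open scoped ComplexStarModule ComplexOrder

variable {D : Type*} [CStarAlgebra D] [PartialOrder D]

/-! The fibre formula is formal. In the fibre at `x` the functions act as the scalars `f x`, so the
fibre of the full free product and the free product of the fibres both classify pairs of unital
`*`-homomorphisms of the two fibres (`exists_fiber_starAlgEquiv`). Upper semicontinuity of fibre
norms holds in every `C(X)`-algebra (`eventually_norm_lt`), so lower semicontinuity is what has to
be proved, and by density only for elements `p` of the algebraic free product.

Suppose `M < ‖p_x‖`. Some representation of the fibre at `x` has a vector `ξ` in the unit ball with
`‖p ξ‖ > M`. Computing `p ξ` involves only finitely many vectors and finitely many elements of `A₁`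
and `A₂`; let `V` be the finite-dimensional span of these vectors. It is enough to find, for each
`y` near `x`, representations of both fibres at `y` on one Hilbert space containing a copy of `V` on
which those elements act almost as before. The universal property then gives a representation of the
fibre of the free product at `y`, and it shows `‖p_y‖ > M`.

For one algebra this is `eventually_exists_linearIsometry`. Continuity of the field and a
Hahn-Banach argument (`exists_positiveLinearMap_of_forall_le`) approximate a vector functional at
`x` by positive functionals at `y`, and the GNS construction turns these into vector functionals.
Splitting into cyclic subspaces extends this to matrices of vector functionals
(`ApproximableAt.of_vectors`), and a polar decomposition yields an exact isometry of `V`.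

The two resulting Hilbert spaces are unrelated, but suitable multiples of them have the same Hilbert
dimension, and a unitary between these multiples can be chosen to match the two copies of `V`
(`exists_common_representation`). Only Hahn-Banach, GNS and multiples of representations enter, so
neither exactness nor separability plays a role. -/

/-- The least nonnegative scalar which dominates the real part of `a`. -/
noncomputable def CStarAlgebra.posBound (a : D) : ℝ :=
  sInf {r : ℝ | 0 ≤ r ∧ (ℜ a : D) ≤ algebraMap ℝ D r}

namespace CStarAlgebra

theorem posBound_le {a : D} {r : ℝ} (hr : 0 ≤ r) (h : (ℜ a : D) ≤ algebraMap ℝ D r) :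
    posBound a ≤ r :=
  csInf_le ⟨0, fun _ h => h.1⟩ ⟨hr, h⟩

variable [StarOrderedRing D]

theorem posBound_nonempty (a : D) : {r : ℝ | 0 ≤ r ∧ (ℜ a : D) ≤ algebraMap ℝ D r}.Nonempty :=
  ⟨‖(ℜ a : D)‖, norm_nonneg _, IsSelfAdjoint.le_algebraMap_norm_self (ℜ a).2⟩

theorem exists_lt_posBound_add (a : D) {δ : ℝ} (hδ : 0 < δ) :
    ∃ r : ℝ, 0 ≤ r ∧ (ℜ a : D) ≤ algebraMap ℝ D r ∧ r < posBound a + δ := by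
  obtain ⟨r, hr, hlt⟩ := exists_lt_of_csInf_lt (posBound_nonempty a)
    (lt_add_of_pos_right (posBound a) hδ)
  exact ⟨r, hr.1, hr.2, hlt⟩

theorem posBound_add_le (a b : D) : posBound (a + b) ≤ posBound a + posBound b := by
  refine le_of_forall_pos_le_add fun δ hδ => ?_
  obtain ⟨r, hr, har, hr'⟩ := exists_lt_posBound_add a (half_pos hδ)
  obtain ⟨t, ht, hbt, ht'⟩ := exists_lt_posBound_add b (half_pos hδ)
  have : posBound (a + b) ≤ r + t := posBound_le (add_nonneg hr ht) <| by
    rw [map_add, map_add]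
    exact add_le_add har hbt
  linarith

theorem posBound_smul_le (a : D) {c : ℝ} (hc : 0 < c) : posBound (c • a) ≤ c * posBound a := by
  refine le_of_forall_pos_le_add fun δ hδ => ?_
  obtain ⟨r, hr, har, hr'⟩ := exists_lt_posBound_add a (div_pos hδ hc)
  have : posBound (c • a) ≤ c * r := posBound_le (mul_nonneg hc.le hr) <| by
    rw [map_smul, map_mul, ← Algebra.smul_def]
    exact smul_le_smul_of_nonneg_left har hc.le
  have h2 : c * r < c * (posBound a + δ / c) := mul_lt_mul_of_pos_left hr' hc
  rw [mul_add, mul_div_cancel₀ _ hc.ne'] at h2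
  linarith

theorem posBound_smul (a : D) {c : ℝ} (hc : 0 < c) : posBound (c • a) = c * posBound a := by
  refine le_antisymm (posBound_smul_le a hc) ?_
  have h := posBound_smul_le (c • a) (inv_pos.2 hc)
  rw [inv_smul_smul₀ hc.ne'] at h
  rwa [le_inv_mul_iff₀ hc] at h

end CStarAlgebra

open CStarAlgebra in
/-- A Hahn-Banach theorem: a linear condition which is necessary for the existence of a positive
functional of mass at most `s` with the approximate values `τ i` on `b i` is sufficient. -/
theorem exists_positiveLinearMap_of_forall_le [StarOrderedRing D] {ι : Type*} [Fintype ι]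
    (b : ι → D)
    (hb : ∀ i, IsSelfAdjoint (b i)) (τ : ι → ℝ) {s ε : ℝ} (hs : 0 ≤ s) (hε : 0 ≤ ε)
    (h : ∀ c : ι → ℝ, ‖c‖ = 1 → ∀ r : ℝ, 0 ≤ r → ∑ i, c i • b i ≤ algebraMap ℝ D r →
      ∑ i, c i * τ i ≤ s * r + ε) :
    ∃ f : D →ₚ[ℂ] ℂ, (f 1).re ≤ s ∧ ∀ i, ‖f (b i) - τ i‖ ≤ ε := by
  classical
  -- Rescaling makes the error term homogeneous, hence the bound sublinear in `c`.
  have h' : ∀ c : ι → ℝ, ∀ r : ℝ, 0 ≤ r → ∑ i, c i • b i ≤ algebraMap ℝ D r →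
      ∑ i, c i * τ i ≤ s * r + ε * ‖c‖ := by
    intro c r hr hc
    rcases eq_or_ne c 0 with rfl | hc0
    · simpa using mul_nonneg hs hr
    have hn : 0 < ‖c‖ := norm_pos_iff.2 hc0
    have := h (‖c‖⁻¹ • c) (by rw [norm_smul, norm_inv, norm_norm, inv_mul_cancel₀ hn.ne'])
      (‖c‖⁻¹ * r) (by positivity) (by
        rw [map_mul, ← Algebra.smul_def]
        simp only [Pi.smul_apply, smul_eq_mul, mul_smul, ← Finset.smul_sum]
        exact smul_le_smul_of_nonneg_left hc (by positivity))
    simp only [Pi.smul_apply, smul_eq_mul, mul_assoc, ← Finset.mul_sum] at this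
    rw [inv_mul_le_iff₀ hn] at this
    calc _ ≤ _ := this
      _ = s * r * (‖c‖ * ‖c‖⁻¹) + ε * ‖c‖ := by ring
      _ = _ := by rw [mul_inv_cancel₀ hn.ne', mul_one]
  let Φ : (ι → ℝ) →ₗ[ℝ] D := Fintype.linearCombination ℝ b
  have hΦ : ∀ c, Φ c = ∑ i, c i • b i := fun c => Fintype.linearCombination_apply ℝ b c
  let T : (ι → ℝ) →ₗ[ℝ] ℝ := Fintype.linearCombination ℝ τ
  have hT : ∀ c, T c = ∑ i, c i * τ i := fun c => Fintype.linearCombination_apply ℝ τ c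
  -- The extension starts from the graph of `Φ`, where `(Φ c, c)` is sent to `T c`. The first
  -- coordinate will give the positive functional, the second absorbs the deviation from `τ`.
  let P : D × (ι → ℝ) → ℝ := fun w => s * posBound w.1 + ε * ‖w.2‖
  let f₀ : (D × (ι → ℝ)) →ₗ.[ℝ] ℝ :=
    { domain := LinearMap.eqLocus (LinearMap.fst ℝ D (ι → ℝ)) (Φ ∘ₗ LinearMap.snd ℝ D (ι → ℝ))
      toFun := (T ∘ₗ LinearMap.snd ℝ D (ι → ℝ)) ∘ₗ Submodule.subtype _ }
  obtain ⟨g, hg, hgP⟩ := exists_extension_of_le_sublinear f₀ P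
    (fun c hc w => by
      simp only [P, Prod.smul_fst, Prod.smul_snd, posBound_smul _ hc, norm_smul,
        Real.norm_of_nonneg hc.le]
      ring)
    (fun v w => by
      have h₁ := mul_le_mul_of_nonneg_left (posBound_add_le v.1 w.1) hs
      have h₂ := mul_le_mul_of_nonneg_left (norm_add_le v.2 w.2) hε
      simp only [P, Prod.fst_add, Prod.snd_add]
      linarith)
    (by
      rintro ⟨⟨d, c⟩, hdc⟩
      have hd : d = Φ c := hdc
      subst hd
      change T c ≤ s * posBound (Φ c) + ε * ‖c‖
      refine le_of_forall_pos_le_add fun δ hδ => ?_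
      obtain ⟨r, hr, hcr, hr'⟩ := exists_lt_posBound_add (Φ c) (δ := δ / (s + 1)) (by positivity)
      have hsa : IsSelfAdjoint (Φ c) := by
        rw [hΦ]
        exact isSelfAdjoint_sum _ fun i _ => (IsSelfAdjoint.all (c i)).smul (hb i)
      rw [hsa.coe_realPart, hΦ] at hcr
      have h₁ := h' c r hr hcr
      have h₂ := mul_le_mul_of_nonneg_left hr'.le hs
      have h₃ : s * (δ / (s + 1)) ≤ δ := by
        rw [mul_div_assoc', div_le_iff₀ (by positivity)]
        nlinarith
      rw [hT]
      linarith)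
  let g₁ : D →ₗ[ℝ] ℝ := g ∘ₗ LinearMap.inl ℝ D (ι → ℝ)
  have hg₁ : ∀ d, g₁ d ≤ s * posBound d := fun d => by
    have := hgP (d, 0)
    simp only [P, norm_zero, mul_zero, add_zero] at this
    exact this
  -- This gives positivity. Applied to both signs of `Complex.I • d` with `d` self-adjoint, it also
  -- makes `F` real on self-adjoint elements.
  have hneg : ∀ d : D, (ℜ d : D) ≤ 0 → g₁ d ≤ 0 := fun d hd => by
    have : posBound d ≤ 0 := posBound_le le_rfl (by simpa using hd)
    nlinarith [hg₁ d]
  let F : D →ₗ[ℂ] ℂ := Module.Dual.extendRCLike g₁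
  have hre : ∀ d, (F d).re = g₁ d := fun d => Module.Dual.re_extendRCLike_apply (𝕜 := ℂ) g₁ d
  have him : ∀ d : D, IsSelfAdjoint d → (F d).im = 0 := fun d hd => by
    have h₁ : (F d).im = -g₁ (Complex.I • d) := Module.Dual.im_extendRCLike_apply (𝕜 := ℂ) g₁ d
    have h₂ : (ℜ (Complex.I • d) : D) = 0 := by
      rw [realPart_I_smul, hd.imaginaryPart]; simp
    have h₃ := hneg _ h₂.le
    have h₄ := hneg (-(Complex.I • d)) (by
      rw [map_neg]
      exact (neg_eq_zero.2 h₂).le)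
    rw [map_neg] at h₄
    rw [h₁]; linarith
  refine ⟨PositiveLinearMap.mk₀ F fun d hd => ?_, ?_, fun i => ?_⟩
  · have hsa : IsSelfAdjoint d := .of_nonneg hd
    rw [Complex.nonneg_iff, him d hsa, hre]
    refine ⟨?_, rfl⟩
    have := hneg (-d) (by rw [map_neg]; simpa [hsa.coe_realPart] using hd)
    rw [map_neg] at this
    linarith
  · change (F 1).re ≤ s
    rw [hre]
    refine (hg₁ 1).trans (mul_le_of_le_one_right hs (posBound_le zero_le_one ?_))
    rw [(IsSelfAdjoint.one D).coe_realPart, map_one]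
  · change ‖F (b i) - τ i‖ ≤ ε
    have h₁ : F (b i) = (g₁ (b i) : ℂ) := Complex.ext (by simp [hre]) (by simp [him _ (hb i)])
    rw [h₁, ← Complex.ofReal_sub, Complex.norm_real, Real.norm_eq_abs]
    -- This point lies on the graph. Hence `τ i` is `g₁ (b i)` plus the value of `g` at `(0,
    -- Pi.single i 1)`, which `P` bounds by `ε` in absolute value.
    have h₂ : g (b i, Pi.single i 1) = τ i := by
      have hmem : (b i, Pi.single i (1 : ℝ)) ∈ f₀.domain := by
        change b i = Φ (Pi.single i 1)
        simp [Φ, Fintype.linearCombination_apply_single]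
      rw [hg ⟨_, hmem⟩]
      change T (Pi.single i 1) = τ i
      simp [T, Fintype.linearCombination_apply_single]
    have h₃ : ∀ c : ι → ℝ, g (0, c) ≤ ε * ‖c‖ := fun c => by
      have : posBound (0 : D) ≤ 0 := posBound_le le_rfl (by simp)
      have h := hgP (0, c)
      simp only [P] at h
      nlinarith
    have h₄ : g (b i, Pi.single i 1) = g₁ (b i) + g (0, Pi.single i 1) := by
      change _ = g (b i, 0) + _
      rw [← map_add]; simp
    have hn : ‖(Pi.single i 1 : ι → ℝ)‖ = 1 := by simp [Pi.norm_single]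
    have h₅ := h₃ (Pi.single i 1)
    have h₆ := h₃ (-Pi.single i 1)
    rw [norm_neg, hn, mul_one] at h₆
    rw [hn, mul_one] at h₅
    have h₇ : g (0, -Pi.single i 1) = - g (0, Pi.single i 1) := by
      rw [← map_neg]; simp
    rw [abs_le]
    constructor <;> linarith

end PositiveFunctional

/-! ### Representations on Hilbert spaces -/

section Representation

open scoped ComplexStarModule ComplexOrder Topology InnerProductSpace

universe u v w

/-- A positive functional is a vector functional of a representation. -/
theorem PositiveLinearMap.exists_representation {D : Type u} [CStarAlgebra D] [PartialOrder D]
    [StarOrderedRing D] (f : D →ₚ[ℂ] ℂ) :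
    ∃ (K : Type u) (_ : NormedAddCommGroup K) (_ : InnerProductSpace ℂ K) (_ : CompleteSpace K)
      (σ : D →⋆ₐ[ℂ] (K →L[ℂ] K)) (ζ : K), ∀ a, ⟪ζ, σ a ζ⟫_ℂ = f a := by
  refine ⟨f.GNS, inferInstance, inferInstance, inferInstance, f.gnsStarAlgHom,
    ((f.toPreGNS 1 : f.PreGNS) : f.GNS), fun a => ?_⟩
  have h : f.gnsStarAlgHom a ((f.toPreGNS 1 : f.PreGNS) : f.GNS) =
      ((f.leftMulMapPreGNS a (f.toPreGNS 1) : f.PreGNS) : f.GNS) :=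
    f.gnsNonUnitalStarAlgHom_apply_coe
  rw [h, UniformSpace.Completion.inner_coe, PositiveLinearMap.preGNS_inner_def]
  simp

theorem inner_map_star_mul {D : Type*} [CStarAlgebra D] {H : Type*} [NormedAddCommGroup H]
    [InnerProductSpace ℂ H] [CompleteSpace H] (π : D →⋆ₐ[ℂ] (H →L[ℂ] H)) (a b : D) (ξ η : H) :
    ⟪ξ, π (star a * b) η⟫_ℂ = ⟪π a ξ, π b η⟫_ℂ := by
  rw [map_mul, map_star, mul_apply_eq_comp, ContinuousLinearMap.star_eq_adjoint,
    ContinuousLinearMap.adjoint_inner_right]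

theorem norm_representation_apply_le {D : Type*} [CStarAlgebra D] {H : Type*}
    [NormedAddCommGroup H] [InnerProductSpace ℂ H] [CompleteSpace H]
    (π : D →⋆ₐ[ℂ] (H →L[ℂ] H)) (a : D) : ‖π a‖ ≤ ‖a‖ :=
  NonUnitalStarAlgHom.norm_apply_le π a

/-- The norm of an element of a C⋆-algebra is attained, up to `ε`, in some representation. -/
theorem exists_representation_lt_norm {D : Type u} [CStarAlgebra D] (a : D) {M : ℝ} (hM : 0 ≤ M)
    (h : M < ‖a‖) :
    ∃ (K : Type u) (_ : NormedAddCommGroup K) (_ : InnerProductSpace ℂ K) (_ : CompleteSpace K)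
      (σ : D →⋆ₐ[ℂ] (K →L[ℂ] K)) (ζ : K), ‖ζ‖ ≤ 1 ∧ M < ‖σ a ζ‖ := by
  let _ := CStarAlgebra.spectralOrder D
  have _ := CStarAlgebra.spectralOrderedRing D
  have hlt : M ^ 2 < ‖a‖ ^ 2 := by gcongr
  -- A functional of mass at most `1` which is nearly `‖a‖ ^ 2` at `star a * a` suffices. The
  -- required inequality is trivial for `c ≤ 0` and is monotonicity of the norm on positive elements
  -- for `c ≥ 0`.
  obtain ⟨f, hf₁, hf⟩ := exists_positiveLinearMap_of_forall_le (ι := Unit)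
    (fun _ => star a * a) (fun _ => .star_mul_self a) (fun _ => ‖a‖ ^ 2) (s := 1)
    (ε := (‖a‖ ^ 2 - M ^ 2) / 2) zero_le_one (by linarith) (by
      intro c hc r hr hle
      simp only [Finset.univ_unique, Finset.sum_singleton] at hle ⊢
      rcases le_total (c default) 0 with h0 | h0
      · nlinarith [mul_nonneg (neg_nonneg.2 h0) (sq_nonneg ‖a‖)]
      · have h₁ := CStarAlgebra.norm_le_norm_of_nonneg_of_le
          (smul_nonneg h0 (star_mul_self_nonneg a)) hle
        rw [norm_smul, CStarRing.norm_star_mul_self, Real.norm_of_nonneg h0, ← sq,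
          Algebra.algebraMap_eq_smul_one, norm_smul, Real.norm_of_nonneg hr] at h₁
        have h₂ : ‖(1 : D)‖ ≤ 1 := by
          rcases subsingleton_or_nontrivial D with hD | hD
          · rw [Subsingleton.elim (1 : D) 0, norm_zero]; exact zero_le_one
          · exact CStarRing.norm_one.le
        nlinarith)
  obtain ⟨K, i₁, i₂, i₃, σ, ζ, hσ⟩ := f.exists_representation
  refine ⟨K, i₁, i₂, i₃, σ, ζ, ?_, ?_⟩
  · have h₁ : ⟪ζ, ζ⟫_ℂ = f 1 := by simpa using hσ 1
    have h₂ : ‖ζ‖ ^ 2 ≤ 1 := by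
      rw [← inner_self_eq_norm_sq (𝕜 := ℂ), h₁]; exact hf₁
    exact (sq_le_one_iff₀ (norm_nonneg _)).1 h₂
  · have h₁ : ‖σ a ζ‖ ^ 2 = (f (star a * a)).re := by
      rw [← hσ, inner_map_star_mul]
      exact (inner_self_eq_norm_sq (𝕜 := ℂ) _).symm
    have h₂ := (Complex.abs_re_le_norm _).trans (hf ())
    rw [Complex.sub_re, Complex.ofReal_re, abs_le] at h₂
    refine lt_of_pow_lt_pow_left₀ 2 (norm_nonneg _) ?_
    rw [h₁]; linarith

theorem inner_realPart_add_imaginaryPart {A : Type*} [CStarAlgebra A] {H : Type*}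
    [NormedAddCommGroup H] [InnerProductSpace ℂ H] (ρ : A →ₗ[ℂ] (H →L[ℂ] H)) (η : H) (a : A) :
    ⟪η, ρ a η⟫_ℂ = ⟪η, ρ (ℜ a : A) η⟫_ℂ + Complex.I * ⟪η, ρ (ℑ a : A) η⟫_ℂ := by
  conv_lhs => rw [← realPart_add_I_smul_imaginaryPart a]
  rw [map_add, map_smul, add_apply, inner_add_right, smul_apply, inner_smul_right]

theorem CStarAlgebra.norm_algebraMap_le {D : Type*} [CStarAlgebra D] {r : ℝ} (hr : 0 ≤ r) :
    ‖algebraMap ℝ D r‖ ≤ r := by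
  rcases subsingleton_or_nontrivial D with hD | hD
  · rwa [Subsingleton.elim (algebraMap ℝ D r) 0, norm_zero]
  · rw [norm_algebraMap', Real.norm_of_nonneg hr]

variable {X : Type w} [TopologicalSpace X] {A : Type u} [CStarAlgebra A] {D : X → Type u}
  [∀ y, CStarAlgebra (D y)]

/-- In a continuous field, the norms of the members of a finite-dimensional family are uniformly
lower semicontinuous. -/
theorem eventually_forall_norm_le_norm_add (q : ∀ y, A →⋆ₐ[ℂ] D y)
    (hq : ∀ a, Continuous fun y => ‖q y a‖) {ι : Type*} [Fintype ι] (b : ι → A) (d : A) (x : X)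
    {ε : ℝ} (hε : 0 < ε) :
    ∀ᶠ y in 𝓝 x, ∀ c : ι → ℝ, ‖c‖ = 1 →
      ‖q x (∑ i, c i • b i + d)‖ ≤ ‖q y (∑ i, c i • b i + d)‖ + ε := by
  let g : (ι → ℝ) → A := fun c => ∑ i, c i • b i + d
  have hg : Continuous g := by fun_prop
  -- The estimate is made jointly in the point and the coefficients, so that compactness of the unit
  -- sphere yields one neighbourhood of `x` for all `c`. Passing between `g z.2` and `g c` costs `ε
  -- / 3` in each of the two fibres, because the maps `q y` are contractive.
  have hcont : ∀ c : ι → ℝ, ∀ᶠ z : X × (ι → ℝ) in 𝓝 (x, c),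
      ‖q x (g z.2)‖ ≤ ‖q z.1 (g z.2)‖ + ε := by
    intro c
    have h₁ : ∀ᶠ z : X × (ι → ℝ) in 𝓝 (x, c), ‖q x (g c)‖ - ε / 3 < ‖q z.1 (g c)‖ :=
      (((hq (g c)).comp continuous_fst).tendsto (x, c)).eventually
        (lt_mem_nhds (by simpa using by positivity))
    have h₂ : ∀ᶠ z : X × (ι → ℝ) in 𝓝 (x, c), ‖g z.2 - g c‖ < ε / 3 := by
      have : Continuous fun z : X × (ι → ℝ) => ‖g z.2 - g c‖ := by fun_prop
      exact (this.tendsto (x, c)).eventually (gt_mem_nhds (by simpa using by positivity))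
    filter_upwards [h₁, h₂] with z hz₁ hz₂
    have h₃ : ∀ y, ‖q y (g z.2) - q y (g c)‖ ≤ ‖g z.2 - g c‖ := fun y => by
      rw [← map_sub]
      exact NonUnitalStarAlgHom.norm_apply_le (q y) _
    have h₄ := norm_sub_norm_le (q x (g z.2)) (q x (g c))
    have h₅ := norm_sub_norm_le (q z.1 (g c)) (q z.1 (g z.2))
    rw [norm_sub_rev] at h₅
    linarith [h₃ x, h₃ z.1]
  filter_upwards [(isCompact_sphere (0 : ι → ℝ) 1).eventually_forall_of_forall_eventually
    (P := fun y c => ‖q x (g c)‖ ≤ ‖q y (g c)‖ + ε) fun c _ => hcont c] with y hy c hc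
  exact hy c (by simpa using hc)

/-- By Hahn-Banach and GNS, only upper bounds for real combinations of `F` have to be compared at
`y` and at `x`. Adding `R` makes every combination with `‖c‖ = 1` positive in all fibres, so an
upper bound becomes a bound of the norm, and norms are lower semicontinuous uniformly in `c`.
Pairing with `ξ` multiplies the loss `ε / (s + 1)` by `s = ‖ξ‖ ^ 2`. -/
theorem eventually_exists_vector_of_isSelfAdjoint (q : ∀ y, A →⋆ₐ[ℂ] D y)
    (hq : ∀ a, Continuous fun y => ‖q y a‖) {H : Type*} [NormedAddCommGroup H]
    [InnerProductSpace ℂ H] [CompleteSpace H] (x : X) (π : D x →⋆ₐ[ℂ] (H →L[ℂ] H)) (ξ : H)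
    (F : Finset A) (hF : ∀ a ∈ F, IsSelfAdjoint a) {ε : ℝ} (hε : 0 < ε) :
    ∀ᶠ y in 𝓝 x, ∃ (K : Type u) (_ : NormedAddCommGroup K) (_ : InnerProductSpace ℂ K)
      (_ : CompleteSpace K) (σ : D y →⋆ₐ[ℂ] (K →L[ℂ] K)) (ζ : K),
      ∀ a ∈ F, ‖⟪ζ, σ (q y a) ζ⟫_ℂ - ⟪ξ, π (q x a) ξ⟫_ℂ‖ ≤ ε := by
  let R : ℝ := ∑ i : F, ‖(i : A)‖
  have hR : 0 ≤ R := Finset.sum_nonneg fun _ _ => norm_nonneg _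
  let s : ℝ := ‖ξ‖ ^ 2
  have hs : 0 ≤ s := sq_nonneg _
  filter_upwards [eventually_forall_norm_le_norm_add q hq (fun i : F => (i : A))
    (algebraMap ℝ A R) x (ε := ε / (s + 1)) (by positivity)] with y hy
  let _ := CStarAlgebra.spectralOrder (D y)
  have _ := CStarAlgebra.spectralOrderedRing (D y)
  have hτ : ∀ a, IsSelfAdjoint a → ((⟪ξ, π (q x a) ξ⟫_ℂ).re : ℂ) = ⟪ξ, π (q x a) ξ⟫_ℂ := by
    intro a ha
    have h : IsSelfAdjoint (π (q x a)) := (ha.map (q x)).map π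
    rw [← Complex.conj_eq_iff_re, inner_conj_symm]
    exact (ContinuousLinearMap.isSelfAdjoint_iff_isSymmetric.1 h) ξ ξ
  obtain ⟨f, -, hf⟩ := exists_positiveLinearMap_of_forall_le (ι := F) (fun i => q y i)
    (fun i => (hF i i.2).map (q y)) (fun i => (⟪ξ, π (q x i) ξ⟫_ℂ).re) (s := s) (ε := ε)
    hs hε.le (by
      intro c hc r hr hle
      have hqR : ∀ z, q z (algebraMap ℝ A R) = algebraMap ℝ (D z) R := fun z => by
        rw [IsScalarTower.algebraMap_apply ℝ ℂ A, IsScalarTower.algebraMap_apply ℝ ℂ (D z)]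
        exact AlgHomClass.commutes (q z) _
      have hqc : ∀ z, q z (∑ i : F, c i • (i : A)) = ∑ i : F, c i • q z i := fun z => by
        rw [map_sum]
        exact Finset.sum_congr rfl fun i _ => by
          rw [← Complex.coe_smul, map_smul, Complex.coe_smul]
      have h₁ : ‖q y (∑ i : F, c i • (i : A) + algebraMap ℝ A R)‖ ≤ r + R := by
        rw [map_add, hqR]
        refine (CStarAlgebra.norm_le_norm_of_nonneg_of_le ?_ (b := algebraMap ℝ (D y) (r + R))
          ?_).trans (CStarAlgebra.norm_algebraMap_le (add_nonneg hr hR))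
        · have hsa : IsSelfAdjoint (q y (∑ i : F, c i • (i : A))) :=
            (isSelfAdjoint_sum _ fun i _ => (IsSelfAdjoint.all (c i)).smul (hF i i.2)).map (q y)
          have hn : ‖q y (∑ i : F, c i • (i : A))‖ ≤ R := by
            refine (NonUnitalStarAlgHom.norm_apply_le (q y) _).trans
              ((norm_sum_le _ _).trans (Finset.sum_le_sum fun i _ => ?_))
            rw [norm_smul]
            exact mul_le_of_le_one_left (norm_nonneg _) ((norm_le_pi_norm c i).trans hc.le)
          have h := hsa.neg_algebraMap_norm_le_self
          have h' : algebraMap ℝ (D y) ‖q y (∑ i : F, c i • (i : A))‖ ≤ algebraMap ℝ (D y) R :=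
            algebraMap_mono _ hn
          rw [neg_le_iff_add_nonneg] at h
          exact h.trans (by gcongr)
        · rw [map_add, hqc]
          gcongr
      have h₂ : ∑ i : F, c i * (⟪ξ, π (q x i) ξ⟫_ℂ).re + R * s ≤
          ‖q x (∑ i : F, c i • (i : A) + algebraMap ℝ A R)‖ * s := by
        have h : (⟪ξ, π (q x (∑ i : F, c i • (i : A) + algebraMap ℝ A R)) ξ⟫_ℂ).re =
            ∑ i : F, c i * (⟪ξ, π (q x i) ξ⟫_ℂ).re + R * s := by
          have hR' : ⟪ξ, ξ⟫_ℂ = (s : ℂ) := by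
            rw [inner_self_eq_norm_sq_to_K]
            simp [s]
          rw [map_add, hqR, hqc, map_add, add_apply, inner_add_right, Complex.add_re, map_sum,
            sum_apply, inner_sum, Complex.re_sum]
          congr 1
          · refine Finset.sum_congr rfl fun i _ => ?_
            rw [← Complex.coe_smul, map_smul, smul_apply, inner_smul_right, Complex.re_ofReal_mul]
          · rw [Algebra.algebraMap_eq_smul_one, ← Complex.coe_smul, map_smul, map_one, smul_apply,
              one_apply_eq_self, inner_smul_right, hR', Complex.re_ofReal_mul, Complex.ofReal_re]
        rw [← h]
        refine (Complex.re_le_norm _).trans ((norm_inner_le_norm _ _).trans ?_)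
        calc _ ≤ ‖ξ‖ * (‖π (q x (∑ i : F, c i • (i : A) + algebraMap ℝ A R))‖ * ‖ξ‖) := by
              gcongr
              exact ContinuousLinearMap.le_opNorm _ _
          _ ≤ ‖ξ‖ * (‖q x (∑ i : F, c i • (i : A) + algebraMap ℝ A R)‖ * ‖ξ‖) := by
              gcongr
              exact norm_representation_apply_le π _
          _ = _ := by ring
      have h₃ := mul_le_mul_of_nonneg_right (hy c hc) hs
      have h₄ : ε / (s + 1) * s ≤ ε := by
        rw [div_mul_eq_mul_div, div_le_iff₀ (by positivity)]
        nlinarith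
      nlinarith)
  obtain ⟨K, i₁, i₂, i₃, σ, ζ, hσ⟩ := f.exists_representation
  refine ⟨K, i₁, i₂, i₃, σ, ζ, fun a ha => ?_⟩
  rw [hσ, ← hτ a (hF a ha)]
  exact hf ⟨a, ha⟩

/-- In a continuous field, vector functionals of a representation of a fibre are approximated, on
finite sets, by vector functionals of representations of the neighbouring fibres. -/
theorem eventually_exists_vector (q : ∀ y, A →⋆ₐ[ℂ] D y)
    (hq : ∀ a, Continuous fun y => ‖q y a‖) {H : Type*} [NormedAddCommGroup H]
    [InnerProductSpace ℂ H] [CompleteSpace H] (x : X) (π : D x →⋆ₐ[ℂ] (H →L[ℂ] H)) (ξ : H)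
    (F : Finset A) {ε : ℝ} (hε : 0 < ε) :
    ∀ᶠ y in 𝓝 x, ∃ (K : Type u) (_ : NormedAddCommGroup K) (_ : InnerProductSpace ℂ K)
      (_ : CompleteSpace K) (σ : D y →⋆ₐ[ℂ] (K →L[ℂ] K)) (ζ : K),
      ∀ a ∈ F, ‖⟪ζ, σ (q y a) ζ⟫_ℂ - ⟪ξ, π (q x a) ξ⟫_ℂ‖ ≤ ε := by
  classical
  -- The real and imaginary parts of the members of `F` each contribute an error of `ε / 2`.
  filter_upwards [eventually_exists_vector_of_isSelfAdjoint q hq x π ξ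
    (F.image (fun a => (ℜ a : A)) ∪ F.image (fun a => (ℑ a : A))) (by
      intro a ha
      simp only [Finset.mem_union, Finset.mem_image] at ha
      rcases ha with ⟨b, -, rfl⟩ | ⟨b, -, rfl⟩
      exacts [(ℜ b).2, (ℑ b).2]) (half_pos hε)] with y hy
  obtain ⟨K, i₁, i₂, i₃, σ, ζ, h⟩ := hy
  refine ⟨K, i₁, i₂, i₃, σ, ζ, fun a ha => ?_⟩
  have h₁ := h _ (Finset.mem_union_left _ (Finset.mem_image_of_mem _ ha))
  have h₂ := h _ (Finset.mem_union_right _ (Finset.mem_image_of_mem _ ha))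
  have h₄ := inner_realPart_add_imaginaryPart (σ.toAlgHom.toLinearMap ∘ₗ (q y).toAlgHom.toLinearMap) ζ a
  have h₅ := inner_realPart_add_imaginaryPart (π.toAlgHom.toLinearMap ∘ₗ (q x).toAlgHom.toLinearMap) ξ a
  change ⟪ζ, σ (q y a) ζ⟫_ℂ = ⟪ζ, σ (q y (ℜ a : A)) ζ⟫_ℂ +
    Complex.I * ⟪ζ, σ (q y (ℑ a : A)) ζ⟫_ℂ at h₄
  change ⟪ξ, π (q x a) ξ⟫_ℂ = ⟪ξ, π (q x (ℜ a : A)) ξ⟫_ℂ +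
    Complex.I * ⟪ξ, π (q x (ℑ a : A)) ξ⟫_ℂ at h₅
  rw [h₄, h₅, add_sub_add_comm, ← mul_sub]
  refine (norm_add_le _ _).trans ?_
  rw [norm_mul, Complex.norm_I, one_mul]
  linarith

end Representation

/-! ### Approximation of representations of a fibre -/

section Approximation

open scoped Topology InnerProductSpace

universe u v w

theorem inner_map_map_map {D : Type*} [CStarAlgebra D] {H : Type*} [NormedAddCommGroup H]
    [InnerProductSpace ℂ H] [CompleteSpace H] (π : D →⋆ₐ[ℂ] (H →L[ℂ] H)) (a b c : D) (ξ η : H) :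
    ⟪ξ, π (star a * (b * c)) η⟫_ℂ = ⟪π a ξ, π b (π c η)⟫_ℂ := by
  rw [inner_map_star_mul, map_mul, mul_apply_eq_comp]

/-- The direct sum of a family of representations. -/
noncomputable def repSum {D : Type*} [CStarAlgebra D] {ι : Type*} {K : ι → Type*}
    [∀ i, NormedAddCommGroup (K i)] [∀ i, InnerProductSpace ℂ (K i)] [∀ i, CompleteSpace (K i)]
    (σ : ∀ i, D →⋆ₐ[ℂ] (K i →L[ℂ] K i)) : D →⋆ₐ[ℂ] (lp K 2 →L[ℂ] lp K 2) where
  toFun a := lp.mapCLM 2 (fun i => σ i a) (norm_nonneg a)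
    fun i => norm_representation_apply_le (σ i) a
  map_one' := by ext x i; simp
  map_mul' a b := by ext x i; simp
  map_zero' := by ext x i; simp
  map_add' a b := by ext x i; simp
  commutes' c := by
    ext x i
    simp [Algebra.algebraMap_eq_smul_one]
  map_star' a := by
    rw [ContinuousLinearMap.star_eq_adjoint, ContinuousLinearMap.eq_adjoint_iff]
    intro x y
    simp only [lp.inner_eq_tsum]
    refine tsum_congr fun i => ?_
    simp only [lp.mapCLM_apply_coe, map_star, ContinuousLinearMap.star_eq_adjoint,
      ContinuousLinearMap.adjoint_inner_left]

theorem repSum_apply {D : Type*} [CStarAlgebra D] {ι : Type*} {K : ι → Type*}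
    [∀ i, NormedAddCommGroup (K i)] [∀ i, InnerProductSpace ℂ (K i)] [∀ i, CompleteSpace (K i)]
    (σ : ∀ i, D →⋆ₐ[ℂ] (K i →L[ℂ] K i)) (a : D) (v : lp K 2) (i : ι) :
    repSum σ a v i = σ i a (v i) := rfl

variable {X : Type w} [TopologicalSpace X] {A : Type u} [CStarAlgebra A] {D : X → Type u}
  [∀ y, CStarAlgebra (D y)]

/-- A matrix `k` of functionals on a continuous field of C⋆-algebras is approximable at `x` if it is
approximated, on finite sets, by the matrices of vector functionals of representations of the
neighbouring fibres. -/
def ApproximableAt (q : ∀ y, A →⋆ₐ[ℂ] D y) (x : X) {ι : Type*} (k : ι → ι → A → ℂ) : Prop :=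
  ∀ (F : Finset A) (ε : ℝ), 0 < ε → ∀ᶠ y in 𝓝 x, ∃ (K : Type u) (_ : NormedAddCommGroup K)
    (_ : InnerProductSpace ℂ K) (_ : CompleteSpace K) (σ : D y →⋆ₐ[ℂ] (K →L[ℂ] K)) (ζ : ι → K),
    ∀ a ∈ F, ∀ i j, ‖⟪ζ i, σ (q y a) (ζ j)⟫_ℂ - k i j a‖ ≤ ε

namespace ApproximableAt

variable {q : ∀ y, A →⋆ₐ[ℂ] D y} {x : X} {ι : Type*}

/-- In a direct sum of representations the matrices of vector functionals add up. -/
theorem sum {κ : Type} [Fintype κ] {k : κ → ι → ι → A → ℂ} (h : ∀ s, ApproximableAt q x (k s)) :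
    ApproximableAt q x (fun i j a => ∑ s, k s i j a) := by
  intro F ε hε
  have hev : ∀ᶠ y in 𝓝 x, ∀ s, _ := Filter.eventually_all.2 fun s =>
    -- The summand `1` admits an empty `κ`, from which `zero` is obtained.
    h s F (ε / (Fintype.card κ + 1)) (by positivity)
  filter_upwards [hev] with y hy
  choose K i₁ i₂ i₃ σ ζ hσ using hy
  have hmem : ∀ i, Memℓp (fun s => ζ s i) 2 := fun i => Memℓp.all _
  refine ⟨lp K 2, inferInstance, inferInstance, inferInstance, repSum σ,
    fun i => ⟨fun s => ζ s i, hmem i⟩, fun a ha i j => ?_⟩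
  rw [lp.inner_eq_tsum, tsum_fintype, ← Finset.sum_sub_distrib]
  calc _ ≤ ∑ _s : κ, ε / (Fintype.card κ + 1) := norm_sum_le_of_le _ fun s _ => hσ s a ha i j
    _ ≤ ε := by
      rw [Finset.sum_const, nsmul_eq_mul, Finset.card_univ, mul_div_assoc',
        div_le_iff₀ (by positivity)]
      nlinarith

theorem add {k l : ι → ι → A → ℂ} (hk : ApproximableAt q x k) (hl : ApproximableAt q x l) :
    ApproximableAt q x (fun i j a => k i j a + l i j a) := by
  simpa using sum (k := fun b : Bool => bif b then k else l) (by simp [hk, hl])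

theorem zero : ApproximableAt q x (fun (_ _ : ι) (_ : A) => 0) := by
  simpa using sum (k := fun (_ : Empty) (_ _ : ι) (_ : A) => 0) (q := q) (x := x) (by simp)

theorem of_approx {k : ι → ι → A → ℂ} (h : ∀ (F : Finset A) (ε : ℝ), 0 < ε →
    ∃ l, ApproximableAt q x l ∧ ∀ a ∈ F, ∀ i j, ‖l i j a - k i j a‖ ≤ ε) :
    ApproximableAt q x k := by
  intro F ε hε
  obtain ⟨l, hl, hlk⟩ := h F (ε / 2) (half_pos hε)
  filter_upwards [hl F (ε / 2) (half_pos hε)] with y hy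
  obtain ⟨K, i₁, i₂, i₃, σ, ζ, hσ⟩ := hy
  refine ⟨K, i₁, i₂, i₃, σ, ζ, fun a ha i j => ?_⟩
  have := norm_sub_le_norm_sub_add_norm_sub (⟪ζ i, σ (q y a) (ζ j)⟫_ℂ) (l i j a) (k i j a)
  linarith [hσ a ha i j, hlk a ha i j]

variable {H : Type*} [NormedAddCommGroup H] [InnerProductSpace ℂ H] [CompleteSpace H]
  [Fintype ι]

/-- All entries come from the single vector functional of `ξ`, evaluated at `star (c i) * (a * c
j)`. A single functional is already covered by `eventually_exists_vector`. -/
theorem of_cyclic (hq : ∀ a, Continuous fun y => ‖q y a‖) (π : D x →⋆ₐ[ℂ] (H →L[ℂ] H))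
    (ξ : H) (c : ι → A) : ApproximableAt q x
    (fun i j a => ⟪π (q x (c i)) ξ, π (q x a) (π (q x (c j)) ξ)⟫_ℂ) := by
  classical
  intro F ε hε
  let F' : Finset A := (F ×ˢ (Finset.univ : Finset (ι × ι))).image
    fun t => star (c t.2.1) * (t.1 * c t.2.2)
  filter_upwards [eventually_exists_vector q hq x π ξ F' hε] with y hy
  obtain ⟨K, i₁, i₂, i₃, σ, ζ, hσ⟩ := hy
  refine ⟨K, i₁, i₂, i₃, σ, fun i => σ (q y (c i)) ζ, fun a ha i j => ?_⟩
  rw [← inner_map_map_map σ, ← inner_map_map_map π]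
  simp only [← map_star, ← map_mul]
  exact hσ _ (Finset.mem_image.2 ⟨(a, i, j), by simp [ha], rfl⟩)

/-- The family is decomposed along reducing subspaces. The projections onto the closed orbit of one
vector are handled by `of_cyclic`, the remainders have one nonzero vector fewer to account for, and
the two matrices add because the subspace and its orthogonal complement are both invariant. -/
theorem of_vectors (hq : ∀ a, Continuous fun y => ‖q y a‖) (π : D x →⋆ₐ[ℂ] (H →L[ℂ] H))
    (η : ι → H) :
    ApproximableAt q x (fun i j a => ⟪η i, π (q x a) (η j)⟫_ℂ) := by
  classical
  -- The induction is on a set supporting the family; the index set `ι` itself stays fixed.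
  suffices h : ∀ (s : Finset ι) (η : ι → H), (∀ i ∉ s, η i = 0) →
      ApproximableAt q x (fun i j a => ⟪η i, π (q x a) (η j)⟫_ℂ) from
    h Finset.univ η (by simp)
  intro s
  induction s using Finset.induction with
  | empty =>
    intro η hη
    simpa [hη] using zero (q := q) (x := x) (ι := ι)
  | insert m s hm ih =>
    intro η hη
    let L : A →ₗ[ℂ] H :=
      { toFun := fun a => π (q x a) (η m)
        map_add' := by simp
        map_smul' := by simp }
    let V : Submodule ℂ H := (LinearMap.range L).topologicalClosure
    have hV : IsClosed (V : Set H) := Submodule.isClosed_topologicalClosure _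
    have : CompleteSpace V := hV.completeSpace_coe
    have hinv : ∀ (a : A), ∀ v ∈ V, π (q x a) v ∈ V := by
      intro a v hv
      refine map_mem_closure (s := (LinearMap.range L : Set H)) (π (q x a)).continuous hv ?_
      rintro _ ⟨b, rfl⟩
      exact ⟨a * b, by simp [L]⟩
    have hm' : η m ∈ V := Submodule.le_topologicalClosure _ ⟨1, by simp [L]⟩
    let P := V.starProjection
    have hP : ∀ v, P v ∈ V := fun v => V.starProjection_apply_mem v
    have hP' : ∀ v, v - P v ∈ Vᗮ := fun v => V.sub_starProjection_mem_orthogonal v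
    have hsplit : (fun i j a => ⟪η i, π (q x a) (η j)⟫_ℂ) = fun i j a =>
        ⟪P (η i), π (q x a) (P (η j))⟫_ℂ +
          ⟪η i - P (η i), π (q x a) (η j - P (η j))⟫_ℂ := by
      ext i j a
      have h₁ : ⟪η i - P (η i), π (q x a) (P (η j))⟫_ℂ = 0 :=
        Submodule.inner_left_of_mem_orthogonal (hinv a _ (hP _)) (hP' _)
      have h₂ : ⟪P (η i), π (q x a) (η j - P (η j))⟫_ℂ = 0 := by
        rw [← ContinuousLinearMap.adjoint_inner_left, ← ContinuousLinearMap.star_eq_adjoint,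
          ← map_star, ← map_star]
        exact Submodule.inner_right_of_mem_orthogonal (hinv (star a) _ (hP _)) (hP' _)
      conv_lhs => rw [← add_sub_cancel (P (η i)) (η i), ← add_sub_cancel (P (η j)) (η j)]
      rw [map_add, inner_add_left, inner_add_right, inner_add_right, h₁, h₂, add_zero, zero_add]
    rw [hsplit]
    -- Each `P (η i)` is a limit of vectors `π (q x c) (η m)`. The remainder at `m` vanishes since
    -- `η m` lies in `V`, so the remainders are supported in `s`.
    refine add (of_approx fun F ε hε => ?_) (ih (fun i => η i - P (η i)) fun i hi => ?_)
    · have hnear : ∀ᶠ v in 𝓝 (fun i => P (η i)), ∀ a ∈ F, ∀ i j,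
          ‖⟪v i, π (q x a) (v j)⟫_ℂ - ⟪P (η i), π (q x a) (P (η j))⟫_ℂ‖ < ε := by
        refine (Filter.eventually_all_finset F).2 fun a _ => Filter.eventually_all.2 fun i =>
          Filter.eventually_all.2 fun j => ?_
        have hc : Continuous fun v : ι → H =>
          ‖⟪v i, π (q x a) (v j)⟫_ℂ - ⟪P (η i), π (q x a) (P (η j))⟫_ℂ‖ := by fun_prop
        exact hc.continuousAt.eventually (gt_mem_nhds (by simpa using hε))
      have hcl : (fun i => P (η i)) ∈ closure (Set.pi Set.univ fun _ : ι =>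
          (LinearMap.range L : Set H)) := by
        rw [closure_pi_set]
        exact fun i _ => hP (η i)
      obtain ⟨v, hv, hvL⟩ := mem_closure_iff_nhds.1 hcl _ hnear
      choose c hc using fun i => hvL i (Set.mem_univ i)
      obtain rfl : (fun i => L (c i)) = v := funext hc
      exact ⟨_, of_cyclic hq π (η m) c, fun a ha i j => (hv a ha i j).le⟩
    · by_cases him : i = m
      · subst him
        exact sub_eq_zero.2 (Submodule.starProjection_eq_self_iff.2 hm').symm
      · simp [hη i (by simp [him, hi])]

end ApproximableAt

end Approximation

/-! ### Isometries which nearly intertwine representations -/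

section Isometry

open scoped Topology InnerProductSpace

universe u v w

/-- An element near the unit has an inverse square root near the unit. -/
theorem IsSelfAdjoint.exists_inv_sqrt {B : Type*} [CStarAlgebra B] {g : B} (hg : IsSelfAdjoint g)
    {δ : ℝ} (h : ‖g - 1‖ ≤ δ) (hδ : δ ≤ 1 / 2) :
    ∃ r : B, IsSelfAdjoint r ∧ r * g * r = 1 ∧ ‖r - 1‖ ≤ 2 * δ := by
  have hsp : ∀ t ∈ spectrum ℝ g, |t - 1| ≤ δ := fun t ht => by
    have h₁ := norm_apply_le_norm_cfc (fun t : ℝ => t - 1) g ht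
    rw [cfc_sub (fun t : ℝ => t) (fun _ => 1) g, cfc_id' ℝ g, cfc_const_one ℝ g] at h₁
    exact h₁.trans h
  have hpos : ∀ t ∈ spectrum ℝ g, 1 / 2 ≤ t := fun t ht => by
    have := (abs_le.1 (hsp t ht)).1
    linarith
  have hsq : ∀ t ∈ spectrum ℝ g, 0 < √t := fun t ht => Real.sqrt_pos.2 (by linarith [hpos t ht])
  have hf : ContinuousOn (fun t : ℝ => (√t)⁻¹) (spectrum ℝ g) :=
    Real.continuous_sqrt.continuousOn.inv₀ fun t ht => (hsq t ht).ne'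
  refine ⟨cfc (fun t : ℝ => (√t)⁻¹) g, cfc_predicate _ g, ?_, ?_⟩
  · have h₁ : cfc (fun t : ℝ => (√t)⁻¹) g * g = cfc (fun t : ℝ => (√t)⁻¹ * t) g := by
      rw [cfc_mul (fun t : ℝ => (√t)⁻¹) (fun t => t) g hf continuousOn_id, cfc_id' ℝ g]
    rw [h₁, ← cfc_mul (fun t : ℝ => (√t)⁻¹ * t) (fun t : ℝ => (√t)⁻¹) g
      (hf.mul continuousOn_id) hf, ← cfc_const_one ℝ g]
    refine cfc_congr fun t ht => ?_
    have h₀ := hsq t ht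
    have h₁ : √t * √t = t := Real.mul_self_sqrt (by linarith [hpos t ht])
    change (√t)⁻¹ * t * (√t)⁻¹ = 1
    nth_rewrite 2 [← h₁]
    field_simp
  · rw [← cfc_const_one ℝ g, ← cfc_sub (fun t : ℝ => (√t)⁻¹) (fun _ => 1) g hf continuousOn_const]
    refine norm_cfc_le (by linarith [norm_nonneg (g - 1)]) fun t ht => ?_
    have h₀ := hsq t ht
    have h₁ : √t * √t = t := Real.mul_self_sqrt (by linarith [hpos t ht])
    have h₂ : 1 / 2 ≤ √t := by nlinarith [hpos t ht]
    -- As `√t ≥ 1 / 2`, the denominator exceeds `1 / 2`, whence the factor `2`.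
    have h₃ : (√t)⁻¹ - 1 = (1 - t) / (√t * (1 + √t)) := by
      field_simp
      nlinarith
    rw [h₃, Real.norm_eq_abs, abs_div, abs_of_pos (a := √t * (1 + √t)) (by positivity),
      div_le_iff₀ (by positivity), abs_sub_comm]
    nlinarith [hsp t ht, abs_nonneg (t - 1)]

/-- An operator which is nearly isometric is near an isometry. -/
theorem ContinuousLinearMap.exists_linearIsometry_near {V K : Type*} [NormedAddCommGroup V]
    [InnerProductSpace ℂ V] [CompleteSpace V] [NormedAddCommGroup K] [InnerProductSpace ℂ K]
    [CompleteSpace K] (S : V →L[ℂ] K) {δ : ℝ} (hδ : δ ≤ 1 / 2)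
    (h : ∀ v w, ‖⟪S v, S w⟫_ℂ - ⟪v, w⟫_ℂ‖ ≤ δ * ‖v‖ * ‖w‖) :
    ∃ T : V →ₗᵢ[ℂ] K, ∀ v, ‖T v - S v‖ ≤ 4 * δ * ‖v‖ := by
  rcases subsingleton_or_nontrivial V with hV | hV
  · refine ⟨⟨0, fun v => by simp [Subsingleton.elim v 0]⟩, fun v => ?_⟩
    simp [Subsingleton.elim v 0]
  have hδ0 : 0 ≤ δ := by
    obtain ⟨v, hv⟩ := exists_ne (0 : V)
    have hv' := norm_pos_iff.2 hv
    have := (norm_nonneg _).trans (h v v)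
    by_contra hneg
    push Not at hneg
    nlinarith [mul_pos hv' hv']
  -- Polar decomposition: with `r` the inverse square root of `g`, the operator `S ∘L r` is
  -- isometric. The constant `4` is the product of `‖S v‖ ≤ 2 * ‖v‖` and `‖r - 1‖ ≤ 2 * δ`.
  let g : V →L[ℂ] V := S.adjoint ∘L S
  have hgi : ∀ v w, ⟪v, g w⟫_ℂ = ⟪S v, S w⟫_ℂ := fun v w => by
    rw [ContinuousLinearMap.comp_apply, ContinuousLinearMap.adjoint_inner_right]
  have hsa : IsSelfAdjoint g :=
    ContinuousLinearMap.isSelfAdjoint_iff_isSymmetric.2 fun v w => by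
      simp [g, ContinuousLinearMap.adjoint_inner_right, ContinuousLinearMap.adjoint_inner_left]
  have hgn : ‖g - 1‖ ≤ δ := by
    refine ContinuousLinearMap.opNorm_le_bound _ hδ0 fun w => ?_
    rcases eq_or_ne ((g - 1) w) 0 with h0 | h0
    · rw [h0, norm_zero]; positivity
    -- The form estimate is tested against `(g - 1) w` itself.
    have h₁ := h ((g - 1) w) w
    rw [← hgi, ← inner_sub_right] at h₁
    change ‖⟪(g - 1) w, (g - 1) w⟫_ℂ‖ ≤ _ at h₁
    rw [inner_self_eq_norm_sq_to_K, norm_pow, RCLike.norm_ofReal, abs_norm] at h₁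
    have h₂ := norm_pos_iff.2 h0
    have h₃ : ‖(g - 1) w‖ * ‖(g - 1) w‖ ≤ ‖(g - 1) w‖ * (δ * ‖w‖) := by nlinarith
    exact le_of_mul_le_mul_left h₃ h₂
  obtain ⟨r, hr, hrg, hrn⟩ := hsa.exists_inv_sqrt hgn hδ
  have hSv : ∀ v, ‖S v‖ ≤ 2 * ‖v‖ := fun v => by
    have h₁ : ‖S v‖ ^ 2 ≤ (2 * ‖v‖) ^ 2 := by
      have h₂ := h v v
      have h₃ := norm_sub_norm_le ⟪S v, S v⟫_ℂ ⟪v, v⟫_ℂ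
      rw [inner_self_eq_norm_sq_to_K, inner_self_eq_norm_sq_to_K, norm_pow, norm_pow,
        RCLike.norm_ofReal, RCLike.norm_ofReal, abs_norm, abs_norm] at h₃
      rw [inner_self_eq_norm_sq_to_K, inner_self_eq_norm_sq_to_K] at h₂
      nlinarith [mul_nonneg (norm_nonneg v) (norm_nonneg v)]
    exact le_of_sq_le_sq h₁ (by positivity)
  refine ⟨⟨(S ∘L r : V →L[ℂ] K), fun v => ?_⟩, fun v => ?_⟩
  · have h₁ : ⟪S (r v), S (r v)⟫_ℂ = ⟪v, v⟫_ℂ := by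
      rw [← hgi, ← ContinuousLinearMap.adjoint_inner_right, ← ContinuousLinearMap.star_eq_adjoint,
        hr.star_eq]
      change ⟪v, (r * g * r) v⟫_ℂ = _
      rw [hrg]; rfl
    change ‖S (r v)‖ = ‖v‖
    rw [@norm_eq_sqrt_re_inner ℂ, h₁, ← @norm_eq_sqrt_re_inner ℂ]
  · change ‖S (r v) - S v‖ ≤ _
    have h₁ : ‖r v - v‖ ≤ 2 * δ * ‖v‖ := (r - 1).le_of_opNorm_le hrn v
    rw [← map_sub]
    linarith [hSv (r v - v)]

variable {X : Type w} [TopologicalSpace X] {A : Type u} [CStarAlgebra A] {D : X → Type u}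
  [∀ y, CStarAlgebra (D y)]

/-- Finite-dimensional spaces of vectors of a representation of a fibre embed isometrically into
representations of the neighbouring fibres, with approximately the same action of `F`. -/
theorem eventually_exists_linearIsometry {q : ∀ y, A →⋆ₐ[ℂ] D y} {x : X}
    (hq : ∀ a, Continuous fun y => ‖q y a‖) {H : Type v} [NormedAddCommGroup H]
    [InnerProductSpace ℂ H] [CompleteSpace H] (π : D x →⋆ₐ[ℂ] (H →L[ℂ] H)) (V : Submodule ℂ H)
    [FiniteDimensional ℂ V] (F : Finset A) {ε : ℝ} (hε : 0 < ε) :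
    ∀ᶠ y in 𝓝 x, ∃ (K : Type u) (_ : NormedAddCommGroup K) (_ : InnerProductSpace ℂ K)
      (_ : CompleteSpace K) (σ : D y →⋆ₐ[ℂ] (K →L[ℂ] K)) (T : V →ₗᵢ[ℂ] K),
      ∀ a ∈ F, ∀ v w : V, π (q x a) v = w → ‖σ (q y a) (T v) - T w‖ ≤ ε * (1 + ‖a‖) * ‖v‖ := by
  classical
  let e := stdOrthonormalBasis ℂ V
  obtain ⟨δ, hδ, hδ2, hδε⟩ : ∃ δ : ℝ, 0 < δ ∧ δ ≤ 1 / 2 ∧ 9 * δ ≤ ε :=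
    ⟨min (1 / 2) (ε / 9), by positivity, min_le_left _ _, by
      linarith [min_le_right (1 / 2) (ε / 9)]⟩
  set n := Module.finrank ℂ V
  -- The element `1` controls inner products, hence how far `S` is from isometric; `a` and `star a *
  -- a` control `‖σ (q y a) (S v) - S w‖ ^ 2`. The tolerance is quadratic in `δ` because a square
  -- root is taken later, and dividing by `n ^ 2 + 1` pays for the sum over pairs of basis vectors.
  filter_upwards [ApproximableAt.of_vectors hq π (fun i => (e i : H))
    ({1} ∪ F ∪ F.image fun a => star a * a) (δ ^ 2 / (n ^ 2 + 1)) (by positivity)] with y hy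
  obtain ⟨K, i₁, i₂, i₃, σ, ζ, hσ⟩ := hy
  let S : V →L[ℂ] K := LinearMap.toContinuousLinearMap (e.toBasis.constr ℂ ζ)
  have hS : ∀ v, S v = ∑ i, e.repr v i • ζ i := fun v => by
    change e.toBasis.constr ℂ ζ v = _
    rw [Module.Basis.constr_apply_fintype]
    simp
  have hform : ∀ a ∈ ({1} ∪ F ∪ F.image fun a => star a * a : Finset A), ∀ v w : V,
      ‖⟪S v, σ (q y a) (S w)⟫_ℂ - ⟪(v : H), π (q x a) w⟫_ℂ‖ ≤ δ ^ 2 * ‖v‖ * ‖w‖ := by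
    intro a ha v w
    have hrepr : ∀ (v : V) i, ‖e.repr v i‖ ≤ ‖v‖ := fun v i => by
      rw [← e.repr.norm_map v]
      exact PiLp.norm_apply_le _ i
    have hv : ∀ v : V, (v : H) = ∑ i, e.repr v i • (e i : H) := fun v => by
      conv_lhs => rw [← e.sum_repr v]
      simp
    have hsum : ⟪S v, σ (q y a) (S w)⟫_ℂ - ⟪(v : H), π (q x a) w⟫_ℂ =
        ∑ i, ∑ j, (starRingEnd ℂ (e.repr v i) * e.repr w j) *
          (⟪ζ i, σ (q y a) (ζ j)⟫_ℂ - ⟪(e i : H), π (q x a) (e j)⟫_ℂ) := by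
      rw [hS, hS, hv v, hv w]
      simp only [map_sum, map_smul, sum_inner, inner_sum (E := K), inner_sum (E := H),
        inner_smul_left, inner_smul_right, mul_sub, Finset.sum_sub_distrib, mul_assoc,
        Finset.mul_sum]
      congr 1
      all_goals
        rw [Finset.sum_comm]
        refine Finset.sum_congr rfl fun i _ => Finset.sum_congr rfl fun j _ => ?_
        ring
    rw [hsum]
    calc _ ≤ ∑ _i : Fin n, ∑ _j : Fin n, (‖v‖ * ‖w‖) * (δ ^ 2 / (n ^ 2 + 1)) := by
          refine norm_sum_le_of_le _ fun i _ => norm_sum_le_of_le _ fun j _ => ?_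
          rw [norm_mul, norm_mul, RCLike.norm_conj]
          exact mul_le_mul (mul_le_mul (hrepr v i) (hrepr w j) (norm_nonneg _) (norm_nonneg _))
            (hσ a ha i j) (norm_nonneg _) (by positivity)
      _ = (n ^ 2 / (n ^ 2 + 1)) * (δ ^ 2 * ‖v‖ * ‖w‖) := by
          simp only [Finset.sum_const, Finset.card_univ, Fintype.card_fin, nsmul_eq_mul]
          ring
      _ ≤ 1 * (δ ^ 2 * ‖v‖ * ‖w‖) := by
          gcongr
          rw [div_le_one (by positivity)]
          linarith
      _ = _ := one_mul _
  have hone : ∀ v w : V, ‖⟪S v, S w⟫_ℂ - ⟪v, w⟫_ℂ‖ ≤ δ ^ 2 * ‖v‖ * ‖w‖ := fun v w => by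
    simpa using hform 1 (by simp) v w
  obtain ⟨T, hT⟩ := S.exists_linearIsometry_near (δ := δ ^ 2) (by nlinarith) hone
  refine ⟨K, i₁, i₂, i₃, σ, T, fun a ha v w hvw => ?_⟩
  have hw : ‖w‖ ≤ ‖a‖ * ‖v‖ := by
    change ‖(w : H)‖ ≤ _
    rw [← hvw]
    exact (π (q x a)).le_of_opNorm_le ((norm_representation_apply_le π _).trans
      (NonUnitalStarAlgHom.norm_apply_le (q x) a)) _
  have hσa : ∀ z, ‖σ (q y a) z‖ ≤ ‖a‖ * ‖z‖ := fun z =>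
    (σ (q y a)).le_of_opNorm_le ((norm_representation_apply_le σ _).trans
      (NonUnitalStarAlgHom.norm_apply_le (q y) a)) _
  -- The square expands into three inner products. Their counterparts in `H` cancel because `π (q x
  -- a) v = w`, and the errors add up to at most `δ ^ 2 * (‖v‖ + ‖w‖) ^ 2`.
  have hmain : ‖σ (q y a) (S v) - S w‖ ^ 2 ≤ (δ * ((1 + ‖a‖) * ‖v‖)) ^ 2 := by
    have h₁ := hform (star a * a) (by simp; exact Or.inr (Or.inr ⟨a, ha, rfl⟩)) v v
    have h₂ := hform a (by simp [ha]) w v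
    have h₃ := hone w w
    rw [map_mul, map_star, inner_map_star_mul, map_mul, map_star, inner_map_star_mul, hvw] at h₁
    rw [hvw] at h₂
    have h₁' := (abs_le.1 ((Complex.abs_re_le_norm _).trans h₁)).2
    have h₂' := (abs_le.1 ((Complex.abs_re_le_norm _).trans h₂)).1
    have h₃' := (abs_le.1 ((Complex.abs_re_le_norm _).trans h₃)).2
    have h₄ : ‖σ (q y a) (S v) - S w‖ ^ 2 = (⟪σ (q y a) (S v), σ (q y a) (S v)⟫_ℂ).re
        - 2 * (⟪S w, σ (q y a) (S v)⟫_ℂ).re + (⟪S w, S w⟫_ℂ).re := by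
      rw [norm_sub_sq (𝕜 := ℂ), inner_re_symm, ← inner_self_eq_norm_sq (𝕜 := ℂ),
        ← inner_self_eq_norm_sq (𝕜 := ℂ)]
      rfl
    have h₅ : ⟪w, w⟫_ℂ = ⟪(w : H), (w : H)⟫_ℂ := rfl
    rw [Complex.sub_re] at h₁' h₂' h₃'
    rw [h₅] at h₃'
    have h₆ : ‖v‖ + ‖w‖ ≤ (1 + ‖a‖) * ‖v‖ := by linarith
    have h₇ : (‖v‖ + ‖w‖) ^ 2 ≤ ((1 + ‖a‖) * ‖v‖) ^ 2 := by gcongr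
    rw [h₄, mul_pow]
    nlinarith [sq_nonneg δ]
  have hmain' := le_of_sq_le_sq hmain (by positivity)
  have h₁ : ‖σ (q y a) (T v - S v)‖ ≤ ‖a‖ * (4 * δ ^ 2 * ‖v‖) :=
    (hσa _).trans (by gcongr; exact hT v)
  have h₂ : ‖T w - S w‖ ≤ 4 * δ ^ 2 * (‖a‖ * ‖v‖) := (hT w).trans (by gcongr)
  -- Replacing `S` by `T` twice costs terms of order `δ ^ 2`, which `δ ≤ 1 / 2` turns into multiples
  -- of `δ`; `9 * δ ≤ ε` leaves room for all three terms.
  have h₃ : σ (q y a) (T v) - T w =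
      σ (q y a) (T v - S v) + (σ (q y a) (S v) - S w) - (T w - S w) := by
    rw [map_sub]; abel
  rw [h₃]
  refine (norm_sub_le _ _).trans ((add_le_add (norm_add_le _ _) le_rfl).trans ?_)
  have h₄ : δ ^ 2 ≤ δ / 2 := by nlinarith
  have h₅ : δ ^ 2 * (‖a‖ * ‖v‖) ≤ δ / 2 * ((1 + ‖a‖) * ‖v‖) := by
    gcongr; linarith
  have h₆ : 9 * δ * ((1 + ‖a‖) * ‖v‖) ≤ ε * ((1 + ‖a‖) * ‖v‖) := by gcongr
  nlinarith [mul_nonneg hδ.le (mul_nonneg (add_nonneg zero_le_one (norm_nonneg a)) (norm_nonneg v))]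

end Isometry

/-! ### Representations of two algebras on a common space -/

section CommonSpace

open scoped InnerProductSpace

universe u v

/-- Two isometric embeddings of a finite-dimensional space into a Hilbert space differ by a
unitary. -/
theorem LinearIsometry.exists_linearIsometryEquiv_apply_eq {V L : Type*} [NormedAddCommGroup V]
    [InnerProductSpace ℂ V] [FiniteDimensional ℂ V] [NormedAddCommGroup L] [InnerProductSpace ℂ L]
    (S T : V →ₗᵢ[ℂ] L) : ∃ U : L ≃ₗᵢ[ℂ] L, ∀ v, U (S v) = T v := by
  -- Inside the finite-dimensional `M` the partial isometry taking `S v` to `T v` extends to an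
  -- isometry of `M`, automatically onto. The unitary acts as the identity on `Mᗮ`.
  let M : Submodule ℂ L := LinearMap.range S.toLinearMap ⊔ LinearMap.range T.toLinearMap
  have hS : ∀ v, S v ∈ M := fun v => Submodule.mem_sup_left ⟨v, rfl⟩
  have hT : ∀ v, T v ∈ M := fun v => Submodule.mem_sup_right ⟨v, rfl⟩
  let S' : V →ₗᵢ[ℂ] M := ⟨S.toLinearMap.codRestrict M hS, fun v => S.norm_map v⟩
  let T' : V →ₗᵢ[ℂ] M := ⟨T.toLinearMap.codRestrict M hT, fun v => T.norm_map v⟩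
  let E : M ≃ₗᵢ[ℂ] M := LinearIsometry.toLinearIsometryEquiv
    (T'.comp S'.equivRange.symm.toLinearIsometry).extend rfl
  have hE : ∀ v, E (S' v) = T' v := fun v => by
    have h := (T'.comp S'.equivRange.symm.toLinearIsometry).extend_apply (S'.equivRange v)
    exact h.trans (congrArg T' (S'.equivRange.symm_apply_apply v))
  refine ⟨(M.orthogonalDecomposition.trans (LinearIsometryEquiv.withLpProdCongr 2 E
    (LinearIsometryEquiv.refl ℂ Mᗮ))).trans M.orthogonalDecomposition.symm, fun v => ?_⟩
  have h₁ : M.orthogonalDecomposition.symm (WithLp.toLp 2 (S' v, 0)) = S v := by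
    simp [S']
    rfl
  have h₂ : M.orthogonalDecomposition.symm (WithLp.toLp 2 (T' v, 0)) = T v := by
    simp [T']
    rfl
  rw [← h₁, ← h₂, LinearIsometryEquiv.trans_apply, LinearIsometryEquiv.trans_apply,
    LinearIsometryEquiv.apply_symm_apply, LinearIsometryEquiv.withLpProdCongr_apply]
  simp [hE]

/-- A Hilbert basis of a space provides one of each of its multiples. -/
theorem HilbertBasis.exists_lp {ι κ γ K : Type*} [NormedAddCommGroup K] [InnerProductSpace ℂ K]
    [CompleteSpace K] (b : HilbertBasis κ ℂ K) (e : γ ≃ ι × κ) :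
    Nonempty (HilbertBasis γ ℂ (lp (fun _ : ι => K) 2)) := by
  classical
  let v : γ → lp (fun _ : ι => K) 2 := fun g => lp.single 2 (e g).1 (b (e g).2)
  have hv : Orthonormal ℂ v := by
    rw [orthonormal_iff_ite]
    intro g h
    rw [lp.inner_single_left, lp.single_apply]
    rcases eq_or_ne (e g).1 (e h).1 with h₁ | h₁
    · rw [h₁, Pi.single_eq_same, orthonormal_iff_ite.1 b.orthonormal]
      have : g = h ↔ (e g).2 = (e h).2 := by
        rw [← e.injective.eq_iff, Prod.ext_iff]
        simp [h₁]
      simp [this]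
    · rw [Pi.single_eq_of_ne h₁, inner_zero_right, if_neg]
      rintro rfl
      exact h₁ rfl
  refine ⟨HilbertBasis.mkOfOrthogonalEqBot hv ?_⟩
  rw [Submodule.eq_bot_iff]
  intro f hf
  ext i
  -- Totality can be tested coordinatewise: each `f i` is orthogonal to the whole basis `b`.
  have h : ∀ k, ⟪b k, f i⟫_ℂ = 0 := fun k => by
    have := Submodule.inner_right_of_mem_orthogonal
      (Submodule.subset_span (Set.mem_range_self (e.symm (i, k)))) hf
    simpa [v, lp.inner_single_left] using this
  refine b.repr.injective ?_
  ext k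
  rw [b.repr_apply_apply, h]
  simp

theorem HilbertBasis.nonempty {ι K : Type*} [NormedAddCommGroup K] [InnerProductSpace ℂ K]
    [Nontrivial K] (b : HilbertBasis ι ℂ K) : Nonempty ι := by
  by_contra hι
  rw [not_nonempty_iff] at hι
  obtain ⟨v, hv⟩ := exists_ne (0 : K)
  refine hv (b.repr.injective ?_)
  ext i
  exact hι.elim i

/-- The transport of a representation by a unitary. -/
noncomputable def repConj {D H K : Type*} [CStarAlgebra D] [NormedAddCommGroup H]
    [InnerProductSpace ℂ H] [CompleteSpace H] [NormedAddCommGroup K] [InnerProductSpace ℂ K]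
    [CompleteSpace K] (W : H ≃ₗᵢ[ℂ] K) (σ : D →⋆ₐ[ℂ] (H →L[ℂ] H)) : D →⋆ₐ[ℂ] (K →L[ℂ] K) :=
  W.conjStarAlgEquiv.toStarAlgHom.comp σ

theorem repConj_apply {D H K : Type*} [CStarAlgebra D] [NormedAddCommGroup H]
    [InnerProductSpace ℂ H] [CompleteSpace H] [NormedAddCommGroup K] [InnerProductSpace ℂ K]
    [CompleteSpace K] (W : H ≃ₗᵢ[ℂ] K) (σ : D →⋆ₐ[ℂ] (H →L[ℂ] H)) (a : D) (v : K) :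
    repConj W σ a v = W (σ a (W.symm v)) := rfl

/-- The embedding of a Hilbert space as a summand of one of its multiples. -/
noncomputable def singleIsometry {ι : Type*} (K : Type*) [NormedAddCommGroup K]
    [InnerProductSpace ℂ K] (i : ι) : K →ₗᵢ[ℂ] lp (fun _ : ι => K) 2 :=
  letI := Classical.decEq ι
  { lp.lsingle (𝕜 := ℂ) (E := fun _ : ι => K) 2 i with
    norm_map' := fun v => lp.norm_single (E := fun _ : ι => K) (p := 2) two_pos i v }

theorem repSum_singleIsometry {D : Type*} [CStarAlgebra D] {ι K : Type*} [NormedAddCommGroup K]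
    [InnerProductSpace ℂ K] [CompleteSpace K] (σ : D →⋆ₐ[ℂ] (K →L[ℂ] K)) (i : ι) (a : D) (v : K) :
    repSum (fun _ : ι => σ) a (singleIsometry K i v) = singleIsometry K i (σ a v) := by
  let _ := Classical.decEq ι
  ext j
  rw [repSum_apply]
  exact Pi.apply_single (fun _ => σ a) (fun _ => map_zero _) i v j

/-- Two Hilbert spaces which contain copies of the same finite-dimensional space have unitarily
equivalent multiples, in which the two copies coincide. -/
theorem exists_linearIsometryEquiv_lp {K₁ : Type u} [NormedAddCommGroup K₁]
    [InnerProductSpace ℂ K₁] [CompleteSpace K₁] {K₂ : Type v} [NormedAddCommGroup K₂]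
    [InnerProductSpace ℂ K₂] [CompleteSpace K₂] {V : Type*} [NormedAddCommGroup V]
    [InnerProductSpace ℂ V] [FiniteDimensional ℂ V] [Nontrivial V] (T₁ : V →ₗᵢ[ℂ] K₁)
    (T₂ : V →ₗᵢ[ℂ] K₂) :
    ∃ (ι₁ : Type u) (ι₂ : Type v) (i₁ : ι₁) (i₂ : ι₂)
      (W : lp (fun _ : ι₁ => K₂) 2 ≃ₗᵢ[ℂ] lp (fun _ : ι₂ => K₁) 2),
      ∀ v, W (singleIsometry K₂ i₁ (T₂ v)) = singleIsometry K₁ i₂ (T₁ v) := by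
  obtain ⟨ι₁, b₁, -⟩ := exists_hilbertBasis ℂ K₁
  obtain ⟨ι₂, b₂, -⟩ := exists_hilbertBasis ℂ K₂
  have : Nontrivial K₁ := T₁.injective.nontrivial
  have : Nontrivial K₂ := T₂.injective.nontrivial
  obtain ⟨i₁⟩ := b₁.nonempty
  obtain ⟨i₂⟩ := b₂.nonempty
  -- Each space is repeated as often as the other has basis vectors, so both multiples have a
  -- Hilbert basis indexed by `ι₂ × ι₁`.
  obtain ⟨c₁⟩ := b₁.exists_lp (Equiv.refl (ι₂ × ι₁))
  obtain ⟨c₂⟩ := b₂.exists_lp (Equiv.prodComm ι₂ ι₁)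
  -- The unitary which matches the bases need not match the copies of `V`; `U` corrects this.
  obtain ⟨U, hU⟩ := LinearIsometry.exists_linearIsometryEquiv_apply_eq
    ((c₂.repr.trans c₁.repr.symm).toLinearIsometry.comp ((singleIsometry K₂ i₁).comp T₂))
    ((singleIsometry K₁ i₂).comp T₁)
  exact ⟨ι₁, ι₂, i₁, i₂, (c₂.repr.trans c₁.repr.symm).trans U, hU⟩

/-- Representations of two algebras which contain copies of the same finite-dimensional space embed
into representations on one Hilbert space, in which the two copies coincide. -/
theorem exists_common_representation {D₁ : Type u} {D₂ : Type v} [CStarAlgebra D₁]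
    [CStarAlgebra D₂] {K₁ : Type u} [NormedAddCommGroup K₁] [InnerProductSpace ℂ K₁]
    [CompleteSpace K₁] {K₂ : Type v} [NormedAddCommGroup K₂] [InnerProductSpace ℂ K₂]
    [CompleteSpace K₂] (σ₁ : D₁ →⋆ₐ[ℂ] (K₁ →L[ℂ] K₁)) (σ₂ : D₂ →⋆ₐ[ℂ] (K₂ →L[ℂ] K₂))
    {V : Type*} [NormedAddCommGroup V] [InnerProductSpace ℂ V] [FiniteDimensional ℂ V]
    [Nontrivial V] (T₁ : V →ₗᵢ[ℂ] K₁) (T₂ : V →ₗᵢ[ℂ] K₂) :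
    ∃ (L : Type (max u v)) (_ : NormedAddCommGroup L) (_ : InnerProductSpace ℂ L)
      (_ : CompleteSpace L) (ρ₁ : D₁ →⋆ₐ[ℂ] (L →L[ℂ] L)) (ρ₂ : D₂ →⋆ₐ[ℂ] (L →L[ℂ] L))
      (T : V →ₗᵢ[ℂ] L),
      (∀ a v w, ‖ρ₁ a (T v) - T w‖ = ‖σ₁ a (T₁ v) - T₁ w‖) ∧
      (∀ a v w, ‖ρ₂ a (T v) - T w‖ = ‖σ₂ a (T₂ v) - T₂ w‖) := by
  obtain ⟨ι₁, ι₂, i₁, i₂, W, hW⟩ := exists_linearIsometryEquiv_lp T₁ T₂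
  have hT : ∀ v, (singleIsometry K₁ i₂).comp T₁ v = singleIsometry K₁ i₂ (T₁ v) := fun _ => rfl
  refine ⟨lp (fun _ : ι₂ => K₁) 2, inferInstance, inferInstance, inferInstance,
    repSum fun _ => σ₁, repConj W (repSum fun _ => σ₂),
    (singleIsometry K₁ i₂).comp T₁, fun a v w => ?_, fun a v w => ?_⟩
  · rw [hT, hT, repSum_singleIsometry, ← map_sub,
      LinearIsometry.norm_map]
  · rw [hT, hT, repConj_apply, ← hW, ← hW,
      W.symm_apply_apply, repSum_singleIsometry, ← map_sub, W.norm_map, ← map_sub,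
      LinearIsometry.norm_map]

end CommonSpace

/-! ### Universal properties -/

theorem StarAlgHom.continuous_of_cstar {A C : Type*} [CStarAlgebra A] [CStarAlgebra C]
    (φ : A →⋆ₐ[ℂ] C) : Continuous φ :=
  AddMonoidHomClass.continuous_of_bound φ 1 fun a => by
    rw [one_mul]
    exact NonUnitalStarAlgHom.norm_apply_le φ a

namespace AmalgFree

universe u v w

section Universal

variable {B : Type w} {A₁ : Type u} {A₂ : Type v} [CStarAlgebra B] [CStarAlgebra A₁]
  [CStarAlgebra A₂] (θ₁ : B →⋆ₐ[ℂ] A₁) (θ₂ : B →⋆ₐ[ℂ] A₂)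

/-- The `*`-homomorphism from `A₁ ⊛_B A₂` defined by a pair of unital `*`-homomorphisms. -/
noncomputable def AlgFreeProd.liftStar {C : Type*} [CStarAlgebra C] (σ₁ : A₁ →⋆ₐ[ℂ] C)
    (σ₂ : A₂ →⋆ₐ[ℂ] C) (h : ∀ b, σ₁ (θ₁ b) = σ₂ (θ₂ b)) : AlgFreeProd θ₁ θ₂ →⋆ₐ[ℂ] C :=
  { AlgFreeProd.lift θ₁ θ₂ (σ₁ : A₁ →ₐ[ℂ] C) (σ₂ : A₂ →ₐ[ℂ] C) h with
    map_star' := fun p => by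
      change AlgFreeProd.lift θ₁ θ₂ (σ₁ : A₁ →ₐ[ℂ] C) (σ₂ : A₂ →ₐ[ℂ] C) h (star p) =
        star (AlgFreeProd.lift θ₁ θ₂ (σ₁ : A₁ →ₐ[ℂ] C) (σ₂ : A₂ →ₐ[ℂ] C) h p)
      induction p using AlgFreeProd.induction θ₁ θ₂ with
      | scalar c => rw [AlgFreeProd.star_algebraMap, AlgHom.commutes, AlgHom.commutes,
          algebraMap_star_comm]
      | hl a =>
        rw [AlgFreeProd.star_inl, AlgFreeProd.lift_inl, AlgFreeProd.lift_inl]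
        exact map_star σ₁ a
      | hr a =>
        rw [AlgFreeProd.star_inr, AlgFreeProd.lift_inr, AlgFreeProd.lift_inr]
        exact map_star σ₂ a
      | add p q hp hq => rw [star_add, map_add, map_add, star_add, hp, hq]
      | mul p q hp hq => rw [star_mul, map_mul, map_mul, star_mul, hp, hq] }

theorem AlgFreeProd.liftStar_inl {C : Type*} [CStarAlgebra C] (σ₁ : A₁ →⋆ₐ[ℂ] C)
    (σ₂ : A₂ →⋆ₐ[ℂ] C) (h : ∀ b, σ₁ (θ₁ b) = σ₂ (θ₂ b)) (a : A₁) :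
    liftStar θ₁ θ₂ σ₁ σ₂ h (inl θ₁ θ₂ a) = σ₁ a :=
  lift_inl θ₁ θ₂ (σ₁ : A₁ →ₐ[ℂ] C) (σ₂ : A₂ →ₐ[ℂ] C) h a

theorem AlgFreeProd.liftStar_inr {C : Type*} [CStarAlgebra C] (σ₁ : A₁ →⋆ₐ[ℂ] C)
    (σ₂ : A₂ →⋆ₐ[ℂ] C) (h : ∀ b, σ₁ (θ₁ b) = σ₂ (θ₂ b)) (a : A₂) :
    liftStar θ₁ θ₂ σ₁ σ₂ h (inr θ₁ θ₂ a) = σ₂ a :=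
  lift_inr θ₁ θ₂ (σ₁ : A₁ →ₐ[ℂ] C) (σ₂ : A₂ →ₐ[ℂ] C) h a

namespace FullFreeProd

variable {C : Type (max u v)} [CStarAlgebra C]

theorem continuous_hom (φ : AlgFreeProd θ₁ θ₂ →⋆ₐ[ℂ] C) : Continuous φ :=
  AddMonoidHomClass.continuous_of_bound φ 1 fun p => by
    rw [one_mul]
    exact AlgFreeProd.norm_hom_le θ₁ θ₂ φ p

/-- The extension of a `*`-homomorphism of the algebraic free product to the full free product, as
a ring homomorphism. -/
noncomputable def extendRingHom (φ : AlgFreeProd θ₁ θ₂ →⋆ₐ[ℂ] C) : FullFreeProd θ₁ θ₂ →+* C :=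
  UniformSpace.Completion.extensionHom (φ : AlgFreeProd θ₁ θ₂ →+* C) (continuous_hom θ₁ θ₂ φ)

theorem extendRingHom_coe (φ : AlgFreeProd θ₁ θ₂ →⋆ₐ[ℂ] C) (p : AlgFreeProd θ₁ θ₂) :
    extendRingHom θ₁ θ₂ φ (coe θ₁ θ₂ p) = φ p :=
  UniformSpace.Completion.extensionHom_coe (φ : AlgFreeProd θ₁ θ₂ →+* C)
    (continuous_hom θ₁ θ₂ φ) p

theorem continuous_extendRingHom (φ : AlgFreeProd θ₁ θ₂ →⋆ₐ[ℂ] C) :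
    Continuous (extendRingHom θ₁ θ₂ φ) :=
  UniformSpace.Completion.continuous_extension

/-- The extension of a `*`-homomorphism of the algebraic free product to the full free product. -/
noncomputable def extend (φ : AlgFreeProd θ₁ θ₂ →⋆ₐ[ℂ] C) : FullFreeProd θ₁ θ₂ →⋆ₐ[ℂ] C :=
  { extendRingHom θ₁ θ₂ φ with
    commutes' := fun c => by
      change extendRingHom θ₁ θ₂ φ (algebraMap ℂ _ c) = _
      rw [← AlgHom.commutes (coe θ₁ θ₂), extendRingHom_coe]
      exact AlgHomClass.commutes φ c
    map_star' := fun z => by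
      change extendRingHom θ₁ θ₂ φ (star z) = star (extendRingHom θ₁ θ₂ φ z)
      have hc := continuous_extendRingHom θ₁ θ₂ φ
      induction z using FullFreeProd.induction θ₁ θ₂ with
      | hC => exact isClosed_eq (hc.comp continuous_star) (continuous_star.comp hc)
      | h p => rw [star_coe, extendRingHom_coe, extendRingHom_coe, map_star] }

theorem extend_coe (φ : AlgFreeProd θ₁ θ₂ →⋆ₐ[ℂ] C) (p : AlgFreeProd θ₁ θ₂) :
    extend θ₁ θ₂ φ (coe θ₁ θ₂ p) = φ p :=
  extendRingHom_coe θ₁ θ₂ φ p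

/-- The `*`-homomorphism of the full free product defined by a pair of unital
`*`-homomorphisms. -/
noncomputable def lift (σ₁ : A₁ →⋆ₐ[ℂ] C) (σ₂ : A₂ →⋆ₐ[ℂ] C) (h : ∀ b, σ₁ (θ₁ b) = σ₂ (θ₂ b)) :
    FullFreeProd θ₁ θ₂ →⋆ₐ[ℂ] C :=
  extend θ₁ θ₂ (AlgFreeProd.liftStar θ₁ θ₂ σ₁ σ₂ h)

theorem lift_coe (σ₁ : A₁ →⋆ₐ[ℂ] C) (σ₂ : A₂ →⋆ₐ[ℂ] C) (h : ∀ b, σ₁ (θ₁ b) = σ₂ (θ₂ b))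
    (p : AlgFreeProd θ₁ θ₂) :
    lift θ₁ θ₂ σ₁ σ₂ h (coe θ₁ θ₂ p) = AlgFreeProd.liftStar θ₁ θ₂ σ₁ σ₂ h p :=
  extend_coe θ₁ θ₂ _ p

theorem lift_inl (σ₁ : A₁ →⋆ₐ[ℂ] C) (σ₂ : A₂ →⋆ₐ[ℂ] C) (h : ∀ b, σ₁ (θ₁ b) = σ₂ (θ₂ b)) (a : A₁) :
    lift θ₁ θ₂ σ₁ σ₂ h (inl θ₁ θ₂ a) = σ₁ a :=
  (lift_coe θ₁ θ₂ σ₁ σ₂ h _).trans (AlgFreeProd.liftStar_inl θ₁ θ₂ σ₁ σ₂ h a)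

theorem lift_inr (σ₁ : A₁ →⋆ₐ[ℂ] C) (σ₂ : A₂ →⋆ₐ[ℂ] C) (h : ∀ b, σ₁ (θ₁ b) = σ₂ (θ₂ b)) (a : A₂) :
    lift θ₁ θ₂ σ₁ σ₂ h (inr θ₁ θ₂ a) = σ₂ a :=
  (lift_coe θ₁ θ₂ σ₁ σ₂ h _).trans (AlgFreeProd.liftStar_inr θ₁ θ₂ σ₁ σ₂ h a)

theorem hom_ext {E : Type*} [CStarAlgebra E] {φ ψ : FullFreeProd θ₁ θ₂ →⋆ₐ[ℂ] E}
    (h₁ : ∀ a, φ (inl θ₁ θ₂ a) = ψ (inl θ₁ θ₂ a)) (h₂ : ∀ a, φ (inr θ₁ θ₂ a) = ψ (inr θ₁ θ₂ a)) :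
    φ = ψ := by
  ext z
  induction z using FullFreeProd.induction θ₁ θ₂ with
  | hC => exact isClosed_eq φ.continuous_of_cstar ψ.continuous_of_cstar
  | h p =>
    induction p using AlgFreeProd.induction θ₁ θ₂ with
    | scalar c =>
      rw [AlgHom.commutes, AlgHomClass.commutes φ, AlgHomClass.commutes ψ]
    | hl a => exact h₁ a
    | hr a => exact h₂ a
    | add p q hp hq => rw [map_add, map_add, map_add, hp, hq]
    | mul p q hp hq => rw [map_mul, map_mul, map_mul, hp, hq]

end FullFreeProd

end Universal

/-! ### Universal property of the fibres and upper semicontinuity of their norms. -/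

namespace CXAlgebra.Fiber

variable {X : Type*} [TopologicalSpace X] [CompactSpace X] {A : Type*} [CStarAlgebra A]
  (S : CXAlgebra X A) (x : X)

/-- The quotient map onto a fibre as a `*`-homomorphism. -/
noncomputable def proj : A →⋆ₐ[ℂ] S.Fiber x :=
  { mk S x with map_star' := fun a => (star_mk S x a).symm }

/-- The function `f - f x` vanishes at `x`. This is why amalgamation over `C(X)` becomes
amalgamation over the scalars in a fibre. -/
theorem proj_hom (f : C(X, ℂ)) : proj S x (S.hom f) = algebraMap ℂ _ (f x) := by
  rw [← AlgHomClass.commutes (proj S x), ← AlgHomClass.commutes S.hom]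
  refine (mk_eq_mk S x).2 ?_
  rw [← map_sub]
  refine S.hom_mem_ideal x ?_
  simp [Algebra.algebraMap_eq_smul_one]

theorem map_eq_zero_of_mem_ideal {C : Type*} [CStarAlgebra C] (φ : A →⋆ₐ[ℂ] C)
    (h : ∀ f : C(X, ℂ), f x = 0 → φ (S.hom f) = 0) {a : A} (ha : a ∈ S.ideal x) : φ a = 0 := by
  refine S.ideal_induction x (C := fun a => φ a = 0)
    (isClosed_eq φ.continuous_of_cstar continuous_const) (map_zero φ) ?_ ?_ ha
  · intro a b ha hb
    rw [map_add, ha, hb, add_zero]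
  · intro a f hf
    rw [map_mul, h f hf, mul_zero]

/-- The `*`-homomorphism of a fibre defined by a `*`-homomorphism which respects evaluation. -/
noncomputable def lift {C : Type*} [CStarAlgebra C] (φ : A →⋆ₐ[ℂ] C)
    (h : ∀ f : C(X, ℂ), f x = 0 → φ (S.hom f) = 0) : S.Fiber x →⋆ₐ[ℂ] C :=
  { Ideal.Quotient.liftₐ (S.ideal x) (φ : A →ₐ[ℂ] C)
      (fun _ ha => map_eq_zero_of_mem_ideal S x φ h ha) with
    map_star' := fun z => by
      obtain ⟨a, rfl⟩ := mk_surjective S x z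
      exact map_star φ a }

/-- The norms of an element of a `C(X)`-algebra in the fibres are upper semicontinuous. -/
theorem eventually_norm_lt (a : A) {M : ℝ} (h : ‖mk S x a‖ < M) :
    ∀ᶠ y in nhds x, ‖mk S y a‖ < M := by
  obtain ⟨b, hb, hbM⟩ := exists_norm_lt S x (mk S x a) (sub_pos.2 h)
  rw [mk_eq_mk] at hb
  have hbM' : ‖b‖ < M := by linarith
  -- The lift `b` of `a_x` already has norm below `M`, and the cutoff makes `b - a` negligible, so
  -- `a * S.hom f` has norm below `M` too.
  obtain ⟨f, hfx, hf, hfb⟩ := exists_cutoff S x hb (sub_pos.2 hbM')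
  have hf' : ‖S.hom f‖ ≤ 1 := (NonUnitalStarAlgHom.norm_apply_le S.hom f).trans hf
  have haf : ‖a * S.hom f‖ < M := by
    have h₁ : a * S.hom f = b * S.hom f - (b - a) * S.hom f := by noncomm_ring
    have h₂ : ‖b * S.hom f‖ ≤ ‖b‖ :=
      (norm_mul_le _ _).trans (mul_le_of_le_one_right (norm_nonneg _) hf')
    rw [h₁]
    linarith [norm_sub_le (b * S.hom f) ((b - a) * S.hom f)]
  -- In the fibre at `y` the cutoff is the scalar `f y`, which is close to `1` for `y` near `x`.
  have hy : ∀ y, ‖mk S y a‖ * ‖f y‖ ≤ ‖a * S.hom f‖ := fun y => by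
    have h₁ : proj S y (a * S.hom f) = f y • mk S y a := by
      rw [map_mul, proj_hom, ← Algebra.commutes, ← Algebra.smul_def]
      rfl
    rw [mul_comm, ← norm_smul, ← h₁]
    exact norm_mk_le S y _
  have hM : 0 < M := (norm_nonneg _).trans_lt h
  have hcont : Filter.Tendsto (fun y => M * ‖f y‖) (nhds x) (nhds M) := by
    have : Continuous fun y => M * ‖f y‖ := by fun_prop
    simpa [hfx] using this.tendsto x
  filter_upwards [hcont.eventually (lt_mem_nhds haf)] with y hlt
  exact lt_of_mul_lt_mul_right ((hy y).trans_lt hlt) (norm_nonneg _)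

end CXAlgebra.Fiber

end AmalgFree

/-! ### Continuity and fibres of full free products -/

namespace AmalgFree

open scoped Topology

universe u v w

section Words

variable {B : Type w} {A₁ : Type u} {A₂ : Type v} [CStarAlgebra B] [CStarAlgebra A₁]
  [CStarAlgebra A₂] (θ₁ : B →⋆ₐ[ℂ] A₁) (θ₂ : B →⋆ₐ[ℂ] A₂)

/-- A linear map which nearly intertwines the actions of finitely many elements of `A₁` and `A₂` on
finitely many vectors nearly intertwines the action of a given element of `A₁ ⊛_B A₂` on a given
vector. -/
theorem AlgFreeProd.exists_norm_apply_sub_le {H : Type*} [NormedAddCommGroup H]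
    [InnerProductSpace ℂ H] [CompleteSpace H] (π : AlgFreeProd θ₁ θ₂ →⋆ₐ[ℂ] (H →L[ℂ] H))
    (p : AlgFreeProd θ₁ θ₂) : ∀ (ξ : H) {ε : ℝ}, 0 < ε →
    ∃ (W : Finset H) (F₁ : Finset A₁) (F₂ : Finset A₂) (δ : ℝ), 0 < δ ∧
      ∀ (L : Type (max u v)) [NormedAddCommGroup L] [InnerProductSpace ℂ L] [CompleteSpace L]
        (ρ : AlgFreeProd θ₁ θ₂ →⋆ₐ[ℂ] (L →L[ℂ] L)) (J : H →ₗ[ℂ] L),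
        (∀ a ∈ F₁, ∀ η ∈ W, ‖ρ (inl θ₁ θ₂ a) (J η) - J (π (inl θ₁ θ₂ a) η)‖ ≤
          δ * (1 + ‖a‖) * ‖η‖) →
        (∀ a ∈ F₂, ∀ η ∈ W, ‖ρ (inr θ₁ θ₂ a) (J η) - J (π (inr θ₁ θ₂ a) η)‖ ≤
          δ * (1 + ‖a‖) * ‖η‖) →
        ‖ρ p (J ξ) - J (π p ξ)‖ ≤ ε := by
  classical
  have hδ : ∀ (r : ℝ) (ξ : H) (ε : ℝ), 0 ≤ r → 0 < ε →
      ε / ((1 + r) * ‖ξ‖ + 1) * (1 + r) * ‖ξ‖ ≤ ε := fun r ξ ε hr hε => by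
    rw [mul_assoc, div_mul_eq_mul_div, div_le_iff₀ (by positivity)]
    nlinarith
  have hmono : ∀ {δ δ' r s t : ℝ}, 0 ≤ r → 0 ≤ s → δ ≤ δ' → t ≤ δ * (1 + r) * s →
      t ≤ δ' * (1 + r) * s := fun hr hs hδ h => h.trans (by gcongr)
  induction p using AlgFreeProd.induction θ₁ θ₂ with
  | scalar c =>
    intro ξ ε hε
    refine ⟨∅, ∅, ∅, 1, one_pos, fun L _ _ _ ρ J _ _ => ?_⟩
    rw [AlgHomClass.commutes ρ, AlgHomClass.commutes π, Algebra.algebraMap_eq_smul_one,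
      Algebra.algebraMap_eq_smul_one, smul_apply, smul_apply, one_apply_eq_self,
      one_apply_eq_self, map_smul, sub_self, norm_zero]
    exact hε.le
  | hl a =>
    intro ξ ε hε
    exact ⟨{ξ}, {a}, ∅, ε / ((1 + ‖a‖) * ‖ξ‖ + 1), by positivity, fun L _ _ _ ρ J h₁ _ =>
      (h₁ a (by simp) ξ (by simp)).trans (hδ _ _ _ (norm_nonneg a) hε)⟩
  | hr a =>
    intro ξ ε hε
    exact ⟨{ξ}, ∅, {a}, ε / ((1 + ‖a‖) * ‖ξ‖ + 1), by positivity, fun L _ _ _ ρ J _ h₂ =>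
      (h₂ a (by simp) ξ (by simp)).trans (hδ _ _ _ (norm_nonneg a) hε)⟩
  | add p q hp hq =>
    intro ξ ε hε
    obtain ⟨W, F₁, F₂, δ, hδ0, h⟩ := hp ξ (half_pos hε)
    obtain ⟨W', F₁', F₂', δ', hδ0', h'⟩ := hq ξ (half_pos hε)
    refine ⟨W ∪ W', F₁ ∪ F₁', F₂ ∪ F₂', min δ δ', lt_min hδ0 hδ0', fun L _ _ _ ρ J h₁ h₂ => ?_⟩
    have e₁ := h L ρ J
      (fun a ha η hη => hmono (norm_nonneg a) (norm_nonneg η) (min_le_left δ δ')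
        (h₁ a (Finset.mem_union_left _ ha) η (Finset.mem_union_left _ hη)))
      (fun a ha η hη => hmono (norm_nonneg a) (norm_nonneg η) (min_le_left δ δ')
        (h₂ a (Finset.mem_union_left _ ha) η (Finset.mem_union_left _ hη)))
    have e₂ := h' L ρ J
      (fun a ha η hη => hmono (norm_nonneg a) (norm_nonneg η) (min_le_right δ δ')
        (h₁ a (Finset.mem_union_right _ ha) η (Finset.mem_union_right _ hη)))
      (fun a ha η hη => hmono (norm_nonneg a) (norm_nonneg η) (min_le_right δ δ')
        (h₂ a (Finset.mem_union_right _ ha) η (Finset.mem_union_right _ hη)))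
    rw [map_add, map_add, add_apply, add_apply, map_add, add_sub_add_comm]
    exact (norm_add_le _ _).trans (by linarith)
  | mul p q hp hq =>
    intro ξ ε hε
    obtain ⟨W, F₁, F₂, δ, hδ0, h⟩ := hp (π q ξ) (half_pos hε)
    -- The error made by `q` is later hit by `ρ p`, whose norm is at most `‖p‖` whatever `ρ` is. The
    -- error made by `p` is measured at the vector `π q ξ`.
    obtain ⟨W', F₁', F₂', δ', hδ0', h'⟩ := hq ξ (ε := ε / 2 / (‖p‖ + 1)) (by positivity)
    refine ⟨W ∪ W', F₁ ∪ F₁', F₂ ∪ F₂', min δ δ', lt_min hδ0 hδ0', fun L _ _ _ ρ J h₁ h₂ => ?_⟩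
    have e₁ := h L ρ J
      (fun a ha η hη => hmono (norm_nonneg a) (norm_nonneg η) (min_le_left δ δ')
        (h₁ a (Finset.mem_union_left _ ha) η (Finset.mem_union_left _ hη)))
      (fun a ha η hη => hmono (norm_nonneg a) (norm_nonneg η) (min_le_left δ δ')
        (h₂ a (Finset.mem_union_left _ ha) η (Finset.mem_union_left _ hη)))
    have e₂ := h' L ρ J
      (fun a ha η hη => hmono (norm_nonneg a) (norm_nonneg η) (min_le_right δ δ')
        (h₁ a (Finset.mem_union_right _ ha) η (Finset.mem_union_right _ hη)))
      (fun a ha η hη => hmono (norm_nonneg a) (norm_nonneg η) (min_le_right δ δ')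
        (h₂ a (Finset.mem_union_right _ ha) η (Finset.mem_union_right _ hη)))
    have e₃ : ‖ρ p (ρ q (J ξ) - J (π q ξ))‖ ≤ ε / 2 := by
      refine ((ρ p).le_of_opNorm_le (norm_hom_le θ₁ θ₂ ρ p) _).trans ?_
      refine (mul_le_mul_of_nonneg_left e₂ (norm_nonneg p)).trans ?_
      rw [mul_div_assoc', div_le_iff₀ (by positivity)]
      nlinarith [norm_nonneg p]
    rw [map_mul, map_mul, mul_apply_eq_comp, mul_apply_eq_comp,
      ← sub_add_sub_cancel (ρ p (ρ q (J ξ))) (ρ p (J (π q ξ))), ← map_sub]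
    exact (norm_add_le _ _).trans (by linarith)

end Words

/-! ### Fibres of the full free product and lower semicontinuity of their norms. -/

namespace CXAlgebra

variable {X : Type w} [TopologicalSpace X] [CompactSpace X]
  {A₁ : Type u} {A₂ : Type v} [CStarAlgebra A₁] [CStarAlgebra A₂]
  (S₁ : CXAlgebra X A₁) (S₂ : CXAlgebra X A₂) (x : X)

theorem hom_fullFreeProd (f : C(X, ℂ)) :
    (S₁.fullFreeProd S₂).hom f = FullFreeProd.inl S₁.hom S₂.hom (S₁.hom f) := rfl

/-- The map of the fibres induced by the inclusion of the left factor. -/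
noncomputable def fiberInl : S₁.Fiber x →⋆ₐ[ℂ] (S₁.fullFreeProd S₂).Fiber x :=
  Fiber.lift S₁ x ((Fiber.proj (S₁.fullFreeProd S₂) x).comp (FullFreeProd.inl S₁.hom S₂.hom))
    fun f hf => by
      rw [StarAlgHom.comp_apply, ← hom_fullFreeProd, Fiber.proj_hom, hf, map_zero]

/-- The map of the fibres induced by the inclusion of the right factor. -/
noncomputable def fiberInr : S₂.Fiber x →⋆ₐ[ℂ] (S₁.fullFreeProd S₂).Fiber x :=
  Fiber.lift S₂ x ((Fiber.proj (S₁.fullFreeProd S₂) x).comp (FullFreeProd.inr S₁.hom S₂.hom))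
    fun f hf => by
      rw [StarAlgHom.comp_apply, ← FullFreeProd.inl_amalg, ← hom_fullFreeProd, Fiber.proj_hom, hf,
        map_zero]

/-- Both sides are the scalar `f x`, so any two unital homomorphisms of the fibres are compatible
with the amalgamation. -/
theorem comp_proj_hom_eq {C : Type*} [CStarAlgebra C] (ρ₁ : S₁.Fiber x →⋆ₐ[ℂ] C)
    (ρ₂ : S₂.Fiber x →⋆ₐ[ℂ] C) (f : C(X, ℂ)) :
    ρ₁.comp (Fiber.proj S₁ x) (S₁.hom f) = ρ₂.comp (Fiber.proj S₂ x) (S₂.hom f) := by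
  rw [StarAlgHom.comp_apply, StarAlgHom.comp_apply, Fiber.proj_hom, Fiber.proj_hom,
    AlgHomClass.commutes ρ₁, AlgHomClass.commutes ρ₂]

section Lift

variable {C : Type (max u v)} [CStarAlgebra C] (ρ₁ : S₁.Fiber x →⋆ₐ[ℂ] C)
  (ρ₂ : S₂.Fiber x →⋆ₐ[ℂ] C)

/-- The `*`-homomorphism of the fibre of the full free product defined by a pair of
`*`-homomorphisms of the fibres. -/
noncomputable def fiberLift : (S₁.fullFreeProd S₂).Fiber x →⋆ₐ[ℂ] C :=
  Fiber.lift _ x (FullFreeProd.lift _ _ _ _ (comp_proj_hom_eq S₁ S₂ x ρ₁ ρ₂)) fun f hf => by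
    rw [hom_fullFreeProd, FullFreeProd.lift_inl, StarAlgHom.comp_apply, Fiber.proj_hom, hf,
      map_zero, map_zero]

theorem fiberLift_fiberInl (a : S₁.Fiber x) :
    fiberLift S₁ S₂ x ρ₁ ρ₂ (fiberInl S₁ S₂ x a) = ρ₁ a := by
  obtain ⟨a, rfl⟩ := Fiber.mk_surjective S₁ x a
  exact FullFreeProd.lift_inl _ _ _ _ (comp_proj_hom_eq S₁ S₂ x ρ₁ ρ₂) a

theorem fiberLift_fiberInr (a : S₂.Fiber x) :
    fiberLift S₁ S₂ x ρ₁ ρ₂ (fiberInr S₁ S₂ x a) = ρ₂ a := by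
  obtain ⟨a, rfl⟩ := Fiber.mk_surjective S₂ x a
  exact FullFreeProd.lift_inr _ _ _ _ (comp_proj_hom_eq S₁ S₂ x ρ₁ ρ₂) a

end Lift

theorem fiber_hom_ext {E : Type*} [CStarAlgebra E]
    {φ ψ : (S₁.fullFreeProd S₂).Fiber x →⋆ₐ[ℂ] E}
    (h₁ : ∀ a, φ (fiberInl S₁ S₂ x a) = ψ (fiberInl S₁ S₂ x a))
    (h₂ : ∀ a, φ (fiberInr S₁ S₂ x a) = ψ (fiberInr S₁ S₂ x a)) : φ = ψ := by
  have h : φ.comp (Fiber.proj _ x) = ψ.comp (Fiber.proj _ x) :=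
    FullFreeProd.hom_ext _ _ (fun a => h₁ (Fiber.mk S₁ x a)) fun a => h₂ (Fiber.mk S₂ x a)
  ext z
  obtain ⟨a, rfl⟩ := Fiber.mk_surjective _ x z
  exact DFunLike.congr_fun h a

/-- The two universal properties give maps in both directions, and these are mutually inverse
because they are so on the images of the two factors. -/
theorem exists_fiber_starAlgEquiv :
    ∃ e : (S₁.fullFreeProd S₂).Fiber x ≃⋆ₐ[ℂ] FullFreeProdC (S₁.Fiber x) (S₂.Fiber x),
      (∀ a, e (fiberInl S₁ S₂ x a) = FullFreeProd.inl _ _ a) ∧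
      ∀ a, e (fiberInr S₁ S₂ x a) = FullFreeProd.inr _ _ a := by
  have h : ∀ c : ℂ, fiberInl S₁ S₂ x (StarAlgHom.ofId ℂ (S₁.Fiber x) c) =
      fiberInr S₁ S₂ x (StarAlgHom.ofId ℂ (S₂.Fiber x) c) := fun c =>
    (AlgHomClass.commutes (fiberInl S₁ S₂ x) c).trans
      (AlgHomClass.commutes (fiberInr S₁ S₂ x) c).symm
  let φ : (S₁.fullFreeProd S₂).Fiber x →⋆ₐ[ℂ] FullFreeProdC (S₁.Fiber x) (S₂.Fiber x) :=
    fiberLift S₁ S₂ x (FullFreeProd.inl _ _) (FullFreeProd.inr _ _)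
  let ψ : FullFreeProdC (S₁.Fiber x) (S₂.Fiber x) →⋆ₐ[ℂ] (S₁.fullFreeProd S₂).Fiber x :=
    FullFreeProd.lift _ _ (fiberInl S₁ S₂ x) (fiberInr S₁ S₂ x) h
  have hφ₁ : ∀ a, φ (fiberInl S₁ S₂ x a) = FullFreeProd.inl _ _ a :=
    fiberLift_fiberInl S₁ S₂ x _ _
  have hφ₂ : ∀ a, φ (fiberInr S₁ S₂ x a) = FullFreeProd.inr _ _ a :=
    fiberLift_fiberInr S₁ S₂ x _ _
  have hψ₁ : ∀ a, ψ (FullFreeProd.inl _ _ a) = fiberInl S₁ S₂ x a :=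
    FullFreeProd.lift_inl _ _ _ _ h
  have hψ₂ : ∀ a, ψ (FullFreeProd.inr _ _ a) = fiberInr S₁ S₂ x a :=
    FullFreeProd.lift_inr _ _ _ _ h
  refine ⟨StarAlgEquiv.ofStarAlgHom φ ψ (fiber_hom_ext S₁ S₂ x (fun a => ?_) fun a => ?_)
    (FullFreeProd.hom_ext _ _ (fun a => ?_) fun a => ?_), hφ₁, hφ₂⟩
  all_goals simp only [StarAlgHom.comp_apply, StarAlgHom.coe_id, id, hφ₁, hφ₂, hψ₁, hψ₂]

/-- The quotient map onto a fibre of the full free product on the algebraic free product. -/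
noncomputable def algProj : AlgFreeProd S₁.hom S₂.hom →⋆ₐ[ℂ] (S₁.fullFreeProd S₂).Fiber x :=
  (Fiber.proj (S₁.fullFreeProd S₂) x).comp
    { FullFreeProd.coe S₁.hom S₂.hom with
      map_star' := fun p => (FullFreeProd.star_coe S₁.hom S₂.hom p).symm }

variable {S₁ S₂}

/-- The norms of an element of the algebraic free product in the fibres of the full free product
are lower semicontinuous. -/
theorem eventually_lt_norm_algProj (h₁ : S₁.IsContinuous) (h₂ : S₂.IsContinuous)
    (p : AlgFreeProd S₁.hom S₂.hom) {M : ℝ} (hM : 0 ≤ M) (h : M < ‖algProj S₁ S₂ x p‖) :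
    ∀ᶠ y in 𝓝 x, M < ‖algProj S₁ S₂ y p‖ := by
  classical
  obtain ⟨H, i₁, i₂, i₃, Φ, ξ, hξ, hlt⟩ := exists_representation_lt_norm _ hM h
  let π : AlgFreeProd S₁.hom S₂.hom →⋆ₐ[ℂ] (H →L[ℂ] H) := Φ.comp (algProj S₁ S₂ x)
  obtain ⟨W, F₁, F₂, δ, hδ, hW⟩ := AlgFreeProd.exists_norm_apply_sub_le _ _ π p ξ
    (ε := (‖Φ (algProj S₁ S₂ x p) ξ‖ - M) / 2) (by linarith)
  -- Besides the vectors of `W`, the space `V` must contain their images under `F₁` and `F₂`, since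
  -- the isometries control `π a η` only when both `η` and `π a η` lie in `V`.
  let G : Finset H := insert ξ (insert (π p ξ) (W ∪
    ((F₁ ×ˢ W).image (fun t => π (AlgFreeProd.inl _ _ t.1) t.2) ∪
      (F₂ ×ˢ W).image (fun t => π (AlgFreeProd.inr _ _ t.1) t.2))))
  let V : Submodule ℂ H := Submodule.span ℂ (G : Set H)
  have hV : ∀ v ∈ G, v ∈ V := fun v hv => Submodule.subset_span hv
  have hξV : ξ ∈ V := hV ξ (by simp [G])
  have hpV : π p ξ ∈ V := hV _ (by simp [G])
  have hWV : ∀ η ∈ W, η ∈ V := fun η hη => hV η (by simp [G, hη])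
  have hF₁ : ∀ a ∈ F₁, ∀ η ∈ W, π (AlgFreeProd.inl _ _ a) η ∈ V := fun a ha η hη =>
    hV _ <| Finset.mem_insert_of_mem <| Finset.mem_insert_of_mem <| Finset.mem_union_right _ <|
      Finset.mem_union_left _ <| Finset.mem_image.2 ⟨(a, η), by simp [ha, hη], rfl⟩
  have hF₂ : ∀ a ∈ F₂, ∀ η ∈ W, π (AlgFreeProd.inr _ _ a) η ∈ V := fun a ha η hη =>
    hV _ <| Finset.mem_insert_of_mem <| Finset.mem_insert_of_mem <| Finset.mem_union_right _ <|
      Finset.mem_union_right _ <| Finset.mem_image.2 ⟨(a, η), by simp [ha, hη], rfl⟩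
  have : FiniteDimensional ℂ V := FiniteDimensional.span_finset ℂ G
  have hξ0 : ξ ≠ 0 := by
    rintro rfl
    rw [map_zero, norm_zero] at hlt
    exact hlt.not_ge hM
  have : Nontrivial V := ⟨⟨⟨ξ, hξV⟩, 0, fun h => hξ0 (congrArg Subtype.val h)⟩⟩
  filter_upwards [eventually_exists_linearIsometry (q := Fiber.proj S₁) h₁
    (Φ.comp (fiberInl S₁ S₂ x)) V F₁ hδ, eventually_exists_linearIsometry (q := Fiber.proj S₂) h₂
    (Φ.comp (fiberInr S₁ S₂ x)) V F₂ hδ] with y hy₁ hy₂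
  obtain ⟨K₁, _, _, _, σ₁, T₁, hT₁⟩ := hy₁
  obtain ⟨K₂, _, _, _, σ₂, T₂, hT₂⟩ := hy₂
  -- On the common space `L` the pair `ρ₁`, `ρ₂` defines a representation of the fibre of the free
  -- product at `y`.
  obtain ⟨L, _, _, _, ρ₁, ρ₂, T, hρ₁, hρ₂⟩ := exists_common_representation σ₁ σ₂ T₁ T₂
  -- The projection merely extends `T` to a linear map on `H`; `J` is evaluated on `V` only.
  let J : H →ₗ[ℂ] L := T.toLinearMap ∘ₗ (V.orthogonalProjectionOnto : H →ₗ[ℂ] V)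
  have hJ : ∀ v (hv : v ∈ V), J v = T ⟨v, hv⟩ := fun v hv =>
    congrArg T (Submodule.orthogonalProjectionOnto_mem_subspace_eq_self ⟨v, hv⟩)
  let ρ := fiberLift S₁ S₂ y ρ₁ ρ₂
  have hmain := hW L (ρ.comp (algProj S₁ S₂ y)) J
    (fun a ha η hη => by
      rw [hJ _ (hF₁ a ha η hη), hJ η (hWV η hη)]
      have e₁ : ρ.comp (algProj S₁ S₂ y) (AlgFreeProd.inl _ _ a) = ρ₁ (Fiber.proj S₁ y a) :=
        fiberLift_fiberInl S₁ S₂ y ρ₁ ρ₂ (Fiber.proj S₁ y a)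
      rw [e₁, hρ₁]
      exact hT₁ a ha _ _ rfl)
    (fun a ha η hη => by
      rw [hJ _ (hF₂ a ha η hη), hJ η (hWV η hη)]
      have e₂ : ρ.comp (algProj S₁ S₂ y) (AlgFreeProd.inr _ _ a) = ρ₂ (Fiber.proj S₂ y a) :=
        fiberLift_fiberInr S₁ S₂ y ρ₁ ρ₂ (Fiber.proj S₂ y a)
      rw [e₂, hρ₂]
      exact hT₂ a ha _ _ rfl)
  have hJp : ‖J (π p ξ)‖ = ‖Φ (algProj S₁ S₂ x p) ξ‖ := by
    rw [hJ _ hpV, T.norm_map]; rfl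
  have hJξ : ‖J ξ‖ ≤ 1 := by
    rw [hJ _ hξV, T.norm_map]; exact hξ
  have hle : ‖ρ.comp (algProj S₁ S₂ y) p (J ξ)‖ ≤ ‖algProj S₁ S₂ y p‖ := by
    refine ((ρ (algProj S₁ S₂ y p)).le_of_opNorm_le (norm_representation_apply_le ρ _) _).trans ?_
    exact mul_le_of_le_one_right (norm_nonneg _) hJξ
  have htri := norm_sub_norm_le (J (π p ξ)) (ρ.comp (algProj S₁ S₂ y) p (J ξ))
  rw [norm_sub_rev, hJp] at htri
  linarith

theorem isContinuous_fullFreeProd (h₁ : S₁.IsContinuous) (h₂ : S₂.IsContinuous) :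
    (S₁.fullFreeProd S₂).IsContinuous := by
  intro z
  induction z using FullFreeProd.induction S₁.hom S₂.hom with
  | hC =>
    -- The fibre maps are contractive, so norm limits in the algebra give uniform limits of the norm
    -- functions.
    refine isClosed_of_closure_subset fun z hz => ?_
    refine continuous_of_uniform_approx_of_continuous fun U hU => ?_
    obtain ⟨ε, hε, hεU⟩ := Metric.mem_uniformity_dist.1 hU
    obtain ⟨w, hw, hzw⟩ := Metric.mem_closure_iff.1 hz ε hε
    refine ⟨_, hw, fun y => hεU ?_⟩
    rw [Real.dist_eq]
    refine (abs_norm_sub_norm_le _ _).trans_lt ?_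
    rw [← map_sub]
    exact (Fiber.norm_mk_le _ y _).trans_lt (by rwa [← dist_eq_norm])
  | h p =>
    rw [continuous_iff_continuousAt]
    intro x
    refine tendsto_order.2 ⟨fun M hM => ?_, fun M hM => Fiber.eventually_norm_lt _ x _ hM⟩
    rcases lt_or_ge M 0 with h0 | h0
    · exact Filter.Eventually.of_forall fun y => h0.trans_le (norm_nonneg _)
    · exact eventually_lt_norm_algProj x h₁ h₂ p h0 hM

end CXAlgebra

end AmalgFree

theorem theorem3p5 {X : Type*} [TopologicalSpace X] [CompactSpace X] [T2Space X]
    {A₁ A₂ : Type*} [CStarAlgebra A₁] [CStarAlgebra A₂]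
    (S₁ : AmalgFree.CXAlgebra X A₁) (S₂ : AmalgFree.CXAlgebra X A₂)
    (h₁ : S₁.IsContinuous) (h₂ : S₂.IsContinuous) :
    (S₁.fullFreeProd S₂).IsContinuous ∧
    ∀ x : X, ∃ e : (S₁.fullFreeProd S₂).Fiber x ≃⋆ₐ[ℂ]
        AmalgFree.FullFreeProdC (S₁.Fiber x) (S₂.Fiber x),
      (∀ a : A₁,
        e (AmalgFree.CXAlgebra.Fiber.mk (S₁.fullFreeProd S₂) x
            (AmalgFree.FullFreeProd.inl S₁.hom S₂.hom a)) =
          AmalgFree.FullFreeProd.inl _ _ (AmalgFree.CXAlgebra.Fiber.mk S₁ x a)) ∧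
      (∀ a : A₂,
        e (AmalgFree.CXAlgebra.Fiber.mk (S₁.fullFreeProd S₂) x
            (AmalgFree.FullFreeProd.inr S₁.hom S₂.hom a)) =
          AmalgFree.FullFreeProd.inr _ _ (AmalgFree.CXAlgebra.Fiber.mk S₂ x a)) := by
  refine ⟨AmalgFree.CXAlgebra.isContinuous_fullFreeProd h₁ h₂, fun x => ?_⟩
  obtain ⟨e, hl, hr⟩ := AmalgFree.CXAlgebra.exists_fiber_starAlgEquiv S₁ S₂ x
  exact ⟨e, fun a => hl (AmalgFree.CXAlgebra.Fiber.mk S₁ x a),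
    fun a => hr (AmalgFree.CXAlgebra.Fiber.mk S₂ x a)⟩
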